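/- For a real random variable $Y$ let $\|Y\|_{\psi_1}=\inf\{c>0:\mathbf{E}\exp(|Y|/c)\le 2\}\in[0,\infty]$. Write $\|\cdot\|$ for the Euclidean norm of a vector and for the corresponding operator norm of a matrix, and let $\mathbf{r}(\Sigma)=\operatorname{tr}(\Sigma)/\|\Sigma\|$ be the effective rank of a positive semi-definite matrix $\Sigma$ (with $\mathbf{r}(0)=0$). There are absolute constants $c_1,c_2,c_3>0$ such that the following holds. Let $X_1,\ldots,X_n$ be independent copies of a zero-mean random vector $X$ in $\mathbb{R}^d$ with covariance matrix $\Sigma$, and suppose that for some $\kappa\ge 1$, \[ \|\langle X,y\rangle\|_{\psi_1}\le\kappa\sqrt{y^{\top}\Sigma y}\quad\text{for all } y\in\mathbb{R}^d, \qquad\text{and}\qquad \max_{1\le i\le n}\|X_i\|\le\kappa\sqrt{\|\Sigma\|}\,(\mathbf{r}(\Sigma)n)^{1/4}\quad\text{almost surely.} \] Then for every $t\ge 0$ such that $n\ge c_3(\mathbf{r}(\Sigma)+t)$, with probability at least $1-c_1e^{-t}$, \[ \left\|\frac1n\sum_{i=1}^nX_iX_i^{\top}-\Sigma\right\|\le c_2\kappa^2\|\Sigma\|\left(\sqrt{\frac{\mathbf{r}(\Sigma)+t}{n}}+\frac{t^2}{n}\right).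 \] -/

import Mathlib

open MeasureTheory ProbabilityTheory
open scoped ENNReal RealInnerProductSpace Matrix

noncomputable section

/-- The `ψ_α` norm `inf {c > 0 : E exp (|Y|^α / c^α) ≤ 2}` of a real random variable `Y` under `μ`,
with values in `[0, ∞]`: it is `∞` when no such `c` exists. -/
def psiNorm {Ω : Type*} [MeasurableSpace Ω] (α : ℝ) (Y : Ω → ℝ) (μ : Measure Ω) : ℝ≥0∞ :=
  ⨅ (c : ℝ) (_ : 0 < c)
    (_ : ∫⁻ ω, ENNReal.ofReal (Real.exp (|Y ω| ^ α / c ^ α)) ∂μ ≤ 2), ENNReal.ofReal c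

/-- The operator norm of a square real matrix with respect to the Euclidean norm. -/
def opNorm {d : ℕ} (M : Matrix (Fin d) (Fin d) ℝ) : ℝ :=
  ‖Matrix.toEuclideanCLM (n := Fin d) (𝕜 := ℝ) M‖

/-- The effective rank `tr M / ‖M‖` of a positive semi-definite matrix (equal to `0` if `M = 0`). -/
def effectiveRank {d : ℕ} (M : Matrix (Fin d) (Fin d) ℝ) : ℝ :=
  M.trace / opNorm M

/-- The covariance matrix of a random vector. -/
def covarianceMatrix {Ω : Type*} [MeasurableSpace Ω] {d : ℕ}
    (X : Ω → EuclideanSpace ℝ (Fin d)) (μ : Measure Ω) : Matrix (Fin d) (Fin d) ℝ :=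
  Matrix.of fun j k => cov[fun ω => X ω j, fun ω => X ω k; μ]

/-- The sample second moment matrix `n⁻¹ ∑ i, x i (x i)ᵀ` of the vectors `x 0, …, x (n - 1)`. -/
def sampleCovariance {n d : ℕ} (x : Fin n → EuclideanSpace ℝ (Fin d)) :
    Matrix (Fin d) (Fin d) ℝ :=
  (n : ℝ)⁻¹ • ∑ i, Matrix.vecMulVec (x i).ofLp (x i).ofLp

end

/-!
The operator norm of the symmetric matrix `sampleCovariance x - S` is the supremum over the unit
ball of `|n⁻¹ ∑ i, ⟪x i, y⟫ ^ 2 - E ⟪X, y⟫ ^ 2|`. Put `K = κ √‖S‖`, `r = effectiveRank S` and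
`a = (r + t) / n`. For each `y`, the coefficients `⟪x i, y⟫` are split at the level `K a ^ (-1/4)`.

The small coefficients are treated by a PAC-Bayes argument (`exists_truncated_event`). The vector
`y` is smoothed into a Gaussian vector `y + g / √β` with `β = r + t`; the change of measure from the
Gaussian prior costs `β / 2` (`integral_shift_le_of_lintegral_exp_le`), and this does not involve
the dimension. Since `E ‖X‖ ^ 4` is at most `48 K ^ 4 r ^ 2`, the smoothing at most multiplies the
fourth moment of `⟪X, y⟫` by a constant. The exponent used is
`w + w ^ 2 - 8 w ^ 4`, truncated from below: its exponential is at most `1 + w + 4 w ^ 2`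
(`exp_truncation_le`), so that two moments suffice, while its Gaussian mean is at least that of `w`
for small coefficients (`le_integral_truncExponent`). The boundedness of the sample makes
the smoothing error small for each `x i`.

The large coefficients are treated by a union bound (`sum_sq_large_inner_le`). They are rounded to
signed dyadic values `± 2 ^ k b`, so that only finitely many vectors of coefficients occur, whatever
`y` is. In the expansion of `‖∑ i, c i • x i‖ ^ 2` the diagonal is controlled by the bound on
`‖x i‖`, and each off-diagonal row is a linear form in `x i` whose direction only depends on earlier
vectors; its exponential moments are obtained by integrating out the vectors successively
(`lintegral_prod_exp_abs_inner_le`). The union bound gives level `k` the prior weight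
`exp (-α 2 ^ k)` at each index (`measure_badSet_le`). The resulting inequality for the largest norm
of a sub-sum is quadratic with a small leading coefficient, and solving it bounds the sum of the
squares of the large coefficients by a multiple of `K ^ 2 (n √a + t ^ 2)`.
-/

/-! ### Predictable linear forms and configurations of levels -/

section Decoupling

/-- The coefficient `± 2 ^ |k| b` encoded by the signed level `k : ℤ`. The level `0` encodes the
coefficient `0`: the corresponding index is not selected. -/
noncomputable def levelCoeff (b : ℝ) (k : ℤ) : ℝ := (k.sign : ℝ) * 2 ^ k.natAbs * b

@[simp] theorem levelCoeff_zero (b : ℝ) : levelCoeff b 0 = 0 := by simp [levelCoeff]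

theorem abs_levelCoeff {b : ℝ} (hb : 0 ≤ b) {k : ℤ} (hk : k ≠ 0) :
    |levelCoeff b k| = 2 ^ k.natAbs * b := by
  have h : |(k.sign : ℝ)| = 1 := by
    rw [← Int.cast_abs, Int.abs_sign_of_ne_zero hk, Int.cast_one]
  rw [levelCoeff, abs_mul, abs_mul, h, one_mul, abs_of_nonneg hb, abs_of_pos (by positivity)]

/-- The cost `α 2 ^ |k|` of putting an index on the level `k ≠ 0`: the negative logarithm of the
prior weight given to this level in the union bound over the configurations. -/
noncomputable def levelCost (α : ℝ) (k : ℤ) : ℝ := if k = 0 then 0 else α * 2 ^ k.natAbs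

theorem levelCost_nonneg {α : ℝ} (hα : 0 ≤ α) (k : ℤ) : 0 ≤ levelCost α k := by
  unfold levelCost; split_ifs <;> positivity

variable {E : Type*} [NormedAddCommGroup E] [InnerProductSpace ℝ E]
variable {ι : Type*} [Fintype ι] [LinearOrder ι]

/-- For a configuration `σ` of signed levels, the part of the sum `∑ j, levelCoeff b (σ j) • x j`
that comes before the index `i`, when indices are ordered by decreasing level and, within a level,
increasingly. It is the vector against which `x i` is tested in the expansion of the squared norm
of the whole sum, and it does not depend on `x i`. -/
noncomputable def earlierSum (b : ℝ) (σ : ι → ℤ) (i : ι) (x : ι → E) : E :=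
  ∑ j with (σ i).natAbs < (σ j).natAbs ∨ (σ j).natAbs = (σ i).natAbs ∧ j < i,
    levelCoeff b (σ j) • x j

/-- The direction of `earlierSum` (the vector `0` if that sum vanishes). -/
noncomputable def earlierDir (b : ℝ) (σ : ι → ℤ) (i : ι) (x : ι → E) : E :=
  ‖earlierSum b σ i x‖⁻¹ • earlierSum b σ i x

theorem norm_earlierDir_le (b : ℝ) (σ : ι → ℤ) (i : ι) (x : ι → E) :
    ‖earlierDir b σ i x‖ ≤ 1 := by
  rw [earlierDir, norm_smul, norm_inv, norm_norm]
  exact inv_mul_le_one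

theorem earlierDir_update (b : ℝ) (σ : ι → ℤ) {i j : ι} (hij : i ≤ j)
    (hσ : (σ j).natAbs = (σ i).natAbs) (x : ι → E) (z : E) :
    earlierDir b σ i (Function.update x j z) = earlierDir b σ i x := by
  have : earlierSum b σ i (Function.update x j z) = earlierSum b σ i x := by
    refine Finset.sum_congr rfl fun l hl => ?_
    have hlj : l ≠ j := by
      rintro rfl
      rcases (Finset.mem_filter.1 hl).2 with h | h
      · omega
      · exact absurd h.2 (not_lt.2 hij)
    rw [Function.update_of_ne hlj]
  rw [earlierDir, earlierDir, this]

/-- The event that, for the configuration `σ`, the linear forms attached to the indices of level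
`k` are larger in total than what the union bound over all configurations with levels at least `k`
can afford. The term with `exp (-(α * 2 ^ k))` pays for the normalisation of the prior weights. -/
def deviationSet (E : Type*) [NormedAddCommGroup E] [InnerProductSpace ℝ E]
    (L b α t : ℝ) (k : ℕ) (σ : ι → ℤ) : Set (ι → E) :=
  {x | L * (3 * ∑ i, levelCost α (σ i) + 4 * Fintype.card ι * Real.exp (-(α * 2 ^ k)) + t)
    < ∑ i with (σ i).natAbs = k, |⟪x i, earlierDir b σ i x⟫|}

variable [MeasurableSpace E] [BorelSpace E] [SecondCountableTopology E]

/-- Exponential moment of a sum of predictable linear forms: when `U i` depends neither on `x i` nor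
on the coordinates of `S` after `i`, the coordinates of `S` can be integrated out one at a time, the
last one first, each costing a factor `2`. -/
theorem lintegral_prod_exp_abs_inner_le (ν : Measure E) [IsProbabilityMeasure ν] {L : ℝ}
    (hν : ∀ u : E, ‖u‖ ≤ 1 → ∫⁻ x, ENNReal.ofReal (Real.exp (|⟪x, u⟫| / L)) ∂ν ≤ 2)
    (S : Finset ι) (U : ι → (ι → E) → E) (hU : ∀ i, Measurable (U i))
    (hU1 : ∀ i x, ‖U i x‖ ≤ 1)
    (hdep : ∀ i ∈ S, ∀ j ∈ S, i ≤ j → ∀ x z, U i (Function.update x j z) = U i x) :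
    ∫⁻ x, ∏ i ∈ S, ENNReal.ofReal (Real.exp (|⟪x i, U i x⟫| / L)) ∂Measure.pi (fun _ => ν)
      ≤ 2 ^ S.card := by
  classical
  have hm : ∀ T : Finset ι, Measurable fun x : ι → E =>
      ∏ i ∈ T, ENNReal.ofReal (Real.exp (|⟪x i, U i x⟫| / L)) := by
    intro T
    refine Finset.measurable_prod _ fun i _ => ?_
    have : Measurable fun x : ι → E => ⟪x i, U i x⟫ := (measurable_pi_apply i).inner (hU i)
    fun_prop
  induction S using Finset.induction_on_max with
  | empty => simp
  | insert a s ha ih =>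
    have has : a ∉ s := fun h => lt_irrefl _ (ha a h)
    have key : ∫⁻ x, ∏ i ∈ insert a s,
          ENNReal.ofReal (Real.exp (|⟪x i, U i x⟫| / L)) ∂Measure.pi (fun _ => ν)
        ≤ ∫⁻ x, 2 * ∏ i ∈ s,
          ENNReal.ofReal (Real.exp (|⟪x i, U i x⟫| / L)) ∂Measure.pi (fun _ => ν) := by
      refine lintegral_le_of_lmarginal_le {a} (hm _) ((hm s).const_mul 2) ?_
      intro x
      rw [lmarginal_singleton, lmarginal_singleton]
      have h1 : ∀ z, ∏ i ∈ s, ENNReal.ofReal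
            (Real.exp (|⟪Function.update x a z i, U i (Function.update x a z)⟫| / L))
          = ∏ i ∈ s, ENNReal.ofReal (Real.exp (|⟪x i, U i x⟫| / L)) := by
        intro z
        refine Finset.prod_congr rfl fun i hi => ?_
        rw [hdep i (Finset.mem_insert_of_mem hi) a (Finset.mem_insert_self _ _) (ha i hi).le,
          Function.update_of_ne (ha i hi).ne]
      simp only [Finset.prod_insert has, h1, Function.update_self,
        hdep a (Finset.mem_insert_self _ _) a (Finset.mem_insert_self _ _) le_rfl]
      rw [lintegral_mul_const' _ _ (ENNReal.prod_ne_top fun _ _ => ENNReal.ofReal_ne_top),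
        lintegral_const, measure_univ, mul_one]
      gcongr
      exact hν _ (hU1 _ _)
    refine key.trans ?_
    rw [lintegral_const_mul _ (hm s), Finset.card_insert_of_notMem has, pow_succ, mul_comm]
    gcongr
    exact ih fun i hi j hj => hdep i (Finset.mem_insert_of_mem hi) j (Finset.mem_insert_of_mem hj)

theorem measurable_earlierDir (b : ℝ) (σ : ι → ℤ) (i : ι) :
    Measurable (earlierDir (E := E) b σ i) := by
  have : Measurable (earlierSum (E := E) b σ i) := by
    unfold earlierSum
    fun_prop
  unfold earlierDir
  fun_prop

theorem measurable_sum_abs_inner_earlierDir (b : ℝ) (k : ℕ) (σ : ι → ℤ) :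
    Measurable fun x : ι → E => ∑ i with (σ i).natAbs = k, |⟪x i, earlierDir b σ i x⟫| := by
  refine Finset.measurable_sum _ fun i _ => ?_
  have : Measurable fun x : ι → E => ⟪x i, earlierDir b σ i x⟫ :=
    (measurable_pi_apply i).inner (measurable_earlierDir b σ i)
  fun_prop

theorem measurableSet_deviationSet (L b α t : ℝ) (k : ℕ) (σ : ι → ℤ) :
    MeasurableSet (deviationSet E L b α t k σ) :=
  measurableSet_lt measurable_const (measurable_sum_abs_inner_earlierDir b k σ)

theorem measure_deviationSet_le (ν : Measure E) [IsProbabilityMeasure ν] {L : ℝ} (hL : 0 < L)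
    (hν : ∀ u : E, ‖u‖ ≤ 1 → ∫⁻ x, ENNReal.ofReal (Real.exp (|⟪x, u⟫| / L)) ∂ν ≤ 2)
    {b α t : ℝ} (hα : 1 ≤ α) {k : ℕ} (hk : k ≠ 0) {σ : ι → ℤ} (hσ : ∃ i, (σ i).natAbs = k) :
    Measure.pi (fun _ => ν) (deviationSet E L b α t k σ)
      ≤ ENNReal.ofReal (Real.exp (-(4 * Fintype.card ι * Real.exp (-(α * 2 ^ k))) - t - α * 2 ^ k)
          * ∏ i, Real.exp (- levelCost α (σ i))) := by
  set S : Finset ι := Finset.univ.filter fun i => (σ i).natAbs = k with hS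
  set A : ℝ := ∑ i, levelCost α (σ i) with hA
  set D : ℝ := 4 * Fintype.card ι * Real.exp (-(α * 2 ^ k)) with hD
  have hmgf := lintegral_prod_exp_abs_inner_le ν hν S (earlierDir b σ)
    (measurable_earlierDir b σ) (norm_earlierDir_le b σ) (by
      intro i hi j hj hij x z
      refine earlierDir_update b σ hij ?_ x z
      rw [(Finset.mem_filter.1 hi).2, (Finset.mem_filter.1 hj).2])
  have hSA : (S.card : ℝ) * (α * 2 ^ k) ≤ A := by
    rw [← nsmul_eq_mul, ← Finset.sum_const]
    calc ∑ _i ∈ S, α * 2 ^ k = ∑ i ∈ S, levelCost α (σ i) := by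
          refine Finset.sum_congr rfl fun i hi => ?_
          have h := (Finset.mem_filter.1 hi).2
          have h0 : σ i ≠ 0 := by rintro h0; rw [h0] at h; simp at h; omega
          rw [levelCost, if_neg h0, h]
      _ ≤ A := Finset.sum_le_sum_of_subset_of_nonneg (Finset.subset_univ _)
          fun i _ _ => levelCost_nonneg (by linarith) _
  have hq : 1 ≤ α * 2 ^ k := by
    have : (1 : ℝ) ≤ 2 ^ k := one_le_pow₀ (by norm_num)
    nlinarith
  have hS1 : (1 : ℝ) ≤ S.card := by
    obtain ⟨i, hi⟩ := hσ
    have : 0 < S.card := Finset.card_pos.2 ⟨i, by simp [hS, hi]⟩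
    exact_mod_cast this
  have hprod : ∀ x : ι → E, ∏ i ∈ S, ENNReal.ofReal (Real.exp (|⟪x i, earlierDir b σ i x⟫| / L))
      = ENNReal.ofReal (Real.exp ((∑ i ∈ S, |⟪x i, earlierDir b σ i x⟫|) / L)) := by
    intro x
    rw [← ENNReal.ofReal_prod_of_nonneg fun i _ => (Real.exp_pos _).le, ← Real.exp_sum,
      Finset.sum_div]
  simp only [hprod] at hmgf
  have hmark := mul_meas_ge_le_lintegral₀ (μ := Measure.pi fun _ : ι => ν)
    (f := fun x => ENNReal.ofReal (Real.exp ((∑ i ∈ S, |⟪x i, earlierDir b σ i x⟫|) / L)))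
    (by
      have := measurable_sum_abs_inner_earlierDir (E := E) b k σ
      exact (by fun_prop : Measurable fun x : ι → E => ENNReal.ofReal
        (Real.exp ((∑ i with (σ i).natAbs = k, |⟪x i, earlierDir b σ i x⟫|) / L))).aemeasurable)
    (ENNReal.ofReal (Real.exp (3 * A + D + t)))
  have hsub : deviationSet E L b α t k σ ⊆ {x | ENNReal.ofReal (Real.exp (3 * A + D + t)) ≤
      ENNReal.ofReal (Real.exp ((∑ i ∈ S, |⟪x i, earlierDir b σ i x⟫|) / L))} := by
    intro x hx
    refine ENNReal.ofReal_le_ofReal (Real.exp_le_exp.2 ?_)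
    rw [le_div_iff₀ hL, mul_comm]
    exact (show _ < _ from hx).le
  -- the cost of the selected indices of level `k` absorbs the factor `2 ^ #S`
  have h2 : (2 : ℝ≥0∞) ^ S.card ≤ ENNReal.ofReal (Real.exp A) := by
    have : (2 : ℝ) ^ S.card ≤ Real.exp A := by
      calc (2 : ℝ) ^ S.card ≤ Real.exp 1 ^ S.card := by
            gcongr
            have := Real.add_one_le_exp 1
            linarith
        _ = Real.exp S.card := by rw [← Real.exp_nat_mul, mul_one]
        _ ≤ Real.exp A := Real.exp_le_exp.2 (by nlinarith)
    calc (2 : ℝ≥0∞) ^ S.card = ENNReal.ofReal (2 ^ S.card) := by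
          rw [ENNReal.ofReal_pow (by norm_num)]; simp
      _ ≤ _ := ENNReal.ofReal_le_ofReal this
  have h3 : ENNReal.ofReal (Real.exp (3 * A + D + t)) *
      Measure.pi (fun _ => ν) (deviationSet E L b α t k σ) ≤ ENNReal.ofReal (Real.exp A) :=
    (by gcongr : _ ≤ _).trans (hmark.trans (hmgf.trans h2))
  have h4 : Measure.pi (fun _ => ν) (deviationSet E L b α t k σ)
      ≤ ENNReal.ofReal (Real.exp (-(3 * A + D + t)) * Real.exp A) := by
    rw [ENNReal.ofReal_mul (Real.exp_pos _).le]
    calc _ = ENNReal.ofReal (Real.exp (-(3 * A + D + t))) *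
          (ENNReal.ofReal (Real.exp (3 * A + D + t)) *
          Measure.pi (fun _ => ν) (deviationSet E L b α t k σ)) := by
          rw [← mul_assoc, ← ENNReal.ofReal_mul (Real.exp_pos _).le, ← Real.exp_add,
            neg_add_cancel, Real.exp_zero, ENNReal.ofReal_one, one_mul]
      _ ≤ _ := by gcongr
  refine h4.trans (ENNReal.ofReal_le_ofReal ?_)
  rw [← Real.exp_sum, ← Real.exp_add, ← Real.exp_add]
  refine Real.exp_le_exp.2 ?_
  rw [Finset.sum_neg_distrib, ← hA]
  nlinarith

end Decoupling

/-! ### The union bound over configurations -/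

section DecouplingUnion

/-- The signed levels of absolute value between `k` and `N`, together with the level `0`. -/
def levelRange (k N : ℕ) : Finset ℤ :=
  insert 0 ((Finset.Icc k N).image (fun l : ℕ => (l : ℤ)) ∪
    (Finset.Icc k N).image (fun l : ℕ => -(l : ℤ)))

theorem mem_levelRange {k N : ℕ} {j : ℤ} :
    j ∈ levelRange k N ↔ j = 0 ∨ (k ≤ j.natAbs ∧ j.natAbs ≤ N) := by
  simp only [levelRange, Finset.mem_insert, Finset.mem_union, Finset.mem_image, Finset.mem_Icc]
  constructor
  · rintro (h | ⟨l, hl, rfl⟩ | ⟨l, hl, rfl⟩)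
    · exact Or.inl h
    · right; simpa using hl
    · right; simpa using hl
  · rintro (h | h)
    · exact Or.inl h
    · right
      rcases Int.natAbs_eq j with hj | hj
      · exact Or.inl ⟨j.natAbs, h, hj.symm⟩
      · exact Or.inr ⟨j.natAbs, h, hj.symm⟩

theorem sum_exp_neg_level_le {α : ℝ} (hα : 1 ≤ α) (k N : ℕ) :
    ∑ l ∈ Finset.Icc k N, Real.exp (-(α * 2 ^ l)) ≤ 2 * Real.exp (-(α * 2 ^ k)) := by
  have h1 : ∀ l ∈ Finset.Icc k N,
      Real.exp (-(α * 2 ^ l)) ≤ Real.exp (-(α * 2 ^ k)) * (1 / 2) ^ (l - k) := by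
    intro l hl
    obtain ⟨m, rfl⟩ := Nat.exists_eq_add_of_le (Finset.mem_Icc.1 hl).1
    have hm : (m : ℝ) + 1 ≤ 2 ^ m := by exact_mod_cast Nat.lt_two_pow_self (n := m)
    have hk : (1 : ℝ) ≤ 2 ^ k := one_le_pow₀ (by norm_num)
    have hαk : 1 ≤ α * 2 ^ k := by nlinarith
    have h : -(α * 2 ^ (k + m)) ≤ -(α * 2 ^ k) + m * (-1) := by
      rw [pow_add]
      nlinarith
    have he : Real.exp (-1) ≤ 1 / 2 := by
      rw [Real.exp_neg, ← one_div]
      have := Real.add_one_le_exp 1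
      exact one_div_le_one_div_of_le (by norm_num) (by linarith)
    calc Real.exp (-(α * 2 ^ (k + m))) ≤ Real.exp (-(α * 2 ^ k) + m * (-1)) :=
          Real.exp_le_exp.2 h
      _ = Real.exp (-(α * 2 ^ k)) * Real.exp (-1) ^ m := by
          rw [Real.exp_add, Real.exp_nat_mul]
      _ ≤ _ := by
          rw [Nat.add_sub_cancel_left]
          gcongr
  refine (Finset.sum_le_sum h1).trans ?_
  rw [← Finset.mul_sum, mul_comm]
  refine mul_le_mul_of_nonneg_right ?_ (Real.exp_pos _).le
  calc ∑ l ∈ Finset.Icc k N, (1 / 2 : ℝ) ^ (l - k)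
      = ∑ m ∈ Finset.range (N + 1 - k), (1 / 2 : ℝ) ^ m := by
        rw [← Finset.Ico_add_one_right_eq_Icc, Finset.sum_Ico_eq_sum_range]
        simp
    _ ≤ ∑' m : ℕ, (1 / 2 : ℝ) ^ m :=
        summable_geometric_two.sum_le_tsum _ fun _ _ => by positivity
    _ = 2 := tsum_geometric_two

theorem sum_levelRange_exp_neg_levelCost_le {α : ℝ} (hα : 1 ≤ α) {k : ℕ} (hk : k ≠ 0) (N : ℕ) :
    ∑ j ∈ levelRange k N, Real.exp (-levelCost α j) ≤ 1 + 4 * Real.exp (-(α * 2 ^ k)) := by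
  have hs := sum_exp_neg_level_le hα k N
  have hcost : ∀ l ∈ Finset.Icc k N, levelCost α (l : ℤ) = α * 2 ^ l ∧
      levelCost α (-(l : ℤ)) = α * 2 ^ l := by
    intro l hl
    have : l ≠ 0 := by have := (Finset.mem_Icc.1 hl).1; omega
    simp [levelCost, this]
  have hA : ∑ j ∈ (Finset.Icc k N).image (fun l : ℕ => (l : ℤ)), Real.exp (-levelCost α j)
      = ∑ l ∈ Finset.Icc k N, Real.exp (-(α * 2 ^ l)) := by
    rw [Finset.sum_image fun a _ b _ h => by simpa using h]
    exact Finset.sum_congr rfl fun l hl => by rw [(hcost l hl).1]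
  have hB : ∑ j ∈ (Finset.Icc k N).image (fun l : ℕ => -(l : ℤ)), Real.exp (-levelCost α j)
      = ∑ l ∈ Finset.Icc k N, Real.exp (-(α * 2 ^ l)) := by
    rw [Finset.sum_image fun a _ b _ h => by simpa using h]
    exact Finset.sum_congr rfl fun l hl => by rw [(hcost l hl).2]
  have h0 : (0 : ℤ) ∉ (Finset.Icc k N).image (fun l : ℕ => (l : ℤ)) ∪
      (Finset.Icc k N).image (fun l : ℕ => -(l : ℤ)) := by
    simp [hk]
  have hU := Finset.sum_union_inter (s₁ := (Finset.Icc k N).image (fun l : ℕ => (l : ℤ)))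
    (s₂ := (Finset.Icc k N).image (fun l : ℕ => -(l : ℤ)))
    (f := fun j => Real.exp (-levelCost α j))
  have hI : 0 ≤ ∑ j ∈ (Finset.Icc k N).image (fun l : ℕ => (l : ℤ)) ∩
      (Finset.Icc k N).image (fun l : ℕ => -(l : ℤ)), Real.exp (-levelCost α j) :=
    Finset.sum_nonneg fun _ _ => (Real.exp_pos _).le
  rw [levelRange, Finset.sum_insert h0]
  have : Real.exp (-levelCost α 0) = 1 := by simp [levelCost]
  linarith

variable {E : Type*} [NormedAddCommGroup E] [InnerProductSpace ℝ E]
variable {ι : Type*} [Fintype ι] [LinearOrder ι]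

/-- The union of the deviation events over all levels `1 ≤ k ≤ N` and all configurations whose
nonzero levels lie between `k` and `N`, and which do use the level `k`. -/
def badSet (E : Type*) [NormedAddCommGroup E] [InnerProductSpace ℝ E] (ι : Type*) [Fintype ι]
    [LinearOrder ι] (L b α t : ℝ) (N : ℕ) : Set (ι → E) :=
  ⋃ k ∈ Finset.Icc 1 N, ⋃ σ ∈ (Fintype.piFinset fun _ : ι => levelRange k N).filter
    fun σ => ∃ i, (σ i).natAbs = k, deviationSet E L b α t k σ

variable [MeasurableSpace E] [BorelSpace E] [SecondCountableTopology E]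

theorem measurableSet_badSet (L b α t : ℝ) (N : ℕ) : MeasurableSet (badSet E ι L b α t N) :=
  Finset.measurableSet_biUnion _ fun _ _ => Finset.measurableSet_biUnion _ fun _ _ =>
    measurableSet_deviationSet _ _ _ _ _ _

/-- The weights `∏ i, exp (-levelCost α (σ i))` of the configurations `σ` sum up to a product over
the indices, so that no counting of configurations is needed in the union bound. -/
theorem measure_badSet_le (ν : Measure E) [IsProbabilityMeasure ν] {L : ℝ} (hL : 0 < L)
    (hν : ∀ u : E, ‖u‖ ≤ 1 → ∫⁻ x, ENNReal.ofReal (Real.exp (|⟪x, u⟫| / L)) ∂ν ≤ 2)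
    {b α t : ℝ} (hα : 1 ≤ α) (N : ℕ) :
    Measure.pi (fun _ => ν) (badSet E ι L b α t N) ≤ ENNReal.ofReal (Real.exp (-t)) := by
  have hlevel : ∀ k ∈ Finset.Icc 1 N, Measure.pi (fun _ => ν)
      (⋃ σ ∈ (Fintype.piFinset fun _ : ι => levelRange k N).filter
        fun σ => ∃ i, (σ i).natAbs = k, deviationSet E L b α t k σ)
      ≤ ENNReal.ofReal (Real.exp (-t) * Real.exp (-(α * 2 ^ k))) := by
    intro k hk
    have hk0 : k ≠ 0 := by have := (Finset.mem_Icc.1 hk).1; omega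
    set D : ℝ := 4 * Fintype.card ι * Real.exp (-(α * 2 ^ k)) with hD
    refine (measure_biUnion_finset_le _ _).trans ?_
    refine (Finset.sum_le_sum fun σ hσ =>
      measure_deviationSet_le ν hL hν hα hk0 (Finset.mem_filter.1 hσ).2).trans ?_
    rw [← ENNReal.ofReal_sum_of_nonneg fun σ _ => by positivity]
    refine ENNReal.ofReal_le_ofReal ?_
    rw [← Finset.mul_sum]
    have h1 : ∑ σ ∈ (Fintype.piFinset fun _ : ι => levelRange k N).filter
          (fun σ => ∃ i, (σ i).natAbs = k), ∏ i, Real.exp (-levelCost α (σ i)) ≤ Real.exp D := by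
      calc _ ≤ ∑ σ ∈ Fintype.piFinset fun _ : ι => levelRange k N,
            ∏ i, Real.exp (-levelCost α (σ i)) :=
            Finset.sum_le_sum_of_subset_of_nonneg (Finset.filter_subset _ _)
              fun _ _ _ => by positivity
        _ = ∏ _i : ι, ∑ j ∈ levelRange k N, Real.exp (-levelCost α j) :=
            (Finset.prod_univ_sum (fun _ : ι => levelRange k N)
              fun _ j => Real.exp (-levelCost α j)).symm
        _ = (∑ j ∈ levelRange k N, Real.exp (-levelCost α j)) ^ Fintype.card ι := by
            rw [Finset.prod_const, Finset.card_univ]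
        _ ≤ Real.exp (4 * Real.exp (-(α * 2 ^ k))) ^ Fintype.card ι := by
            gcongr
            have := sum_levelRange_exp_neg_levelCost_le hα hk0 N
            have := Real.add_one_le_exp (4 * Real.exp (-(α * 2 ^ k)))
            linarith
        _ = Real.exp D := by
            rw [← Real.exp_nat_mul, hD]
            ring_nf
    calc _ ≤ Real.exp (-D - t - α * 2 ^ k) * Real.exp D := by gcongr
      _ = _ := by
        rw [← Real.exp_add, ← Real.exp_add]
        ring_nf
  refine (measure_biUnion_finset_le _ _).trans ((Finset.sum_le_sum hlevel).trans ?_)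
  rw [← ENNReal.ofReal_sum_of_nonneg fun σ _ => by positivity, ← Finset.mul_sum]
  refine ENNReal.ofReal_le_ofReal (mul_le_of_le_one_right (Real.exp_pos _).le ?_)
  refine (sum_exp_neg_level_le hα 1 N).trans ?_
  have : Real.exp (-(α * 2 ^ 1)) ≤ Real.exp (-1) := Real.exp_le_exp.2 (by linarith)
  have he : Real.exp (-1) ≤ 1 / 2 := by
    rw [Real.exp_neg, ← one_div]
    have := Real.add_one_le_exp 1
    exact one_div_le_one_div_of_le (by norm_num) (by linarith)
  linarith

end DecouplingUnion

/-! ### Large coefficients -/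

section LargeCoefficients

variable {E : Type*} [NormedAddCommGroup E] [InnerProductSpace ℝ E]
variable {ι : Type*} [Fintype ι] [LinearOrder ι]

/-- Expansion of the squared norm along the order that defines `earlierSum`. -/
theorem norm_sq_sum_levelCoeff (b : ℝ) (σ : ι → ℤ) (x : ι → E) :
    ‖∑ i, levelCoeff b (σ i) • x i‖ ^ 2 = ∑ i, levelCoeff b (σ i) ^ 2 * ‖x i‖ ^ 2
      + 2 * ∑ i, levelCoeff b (σ i) * ⟪x i, earlierSum b σ i x⟫ := by
  set a : ι → ι → ℝ := fun i j => levelCoeff b (σ i) * (levelCoeff b (σ j) * ⟪x i, x j⟫) with ha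
  set prec : ι → ι → Prop := fun j i =>
    (σ i).natAbs < (σ j).natAbs ∨ (σ j).natAbs = (σ i).natAbs ∧ j < i with hprec
  have hsymm : ∀ i j, a i j = a j i := by
    intro i j
    simp only [ha, real_inner_comm (x i) (x j)]
    ring
  have hsplit : ∀ i j, a i j = (if j = i then a i j else 0) + (if prec j i then a i j else 0)
      + (if prec i j then a i j else 0) := by
    intro i j
    by_cases h : j = i
    · subst h
      simp [hprec]
    · have hiff : prec i j ↔ ¬ prec j i := by
        simp only [hprec]
        rcases lt_or_gt_of_ne h with h' | h'
        · simp only [h', h'.not_gt, and_true, and_false, or_false]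
          omega
        · simp only [h', h'.not_gt, and_true, and_false, or_false]
          omega
      by_cases h' : prec j i <;> simp [h, hiff, h']
  have h1 : ‖∑ i, levelCoeff b (σ i) • x i‖ ^ 2 = ∑ i, ∑ j, a i j := by
    rw [← real_inner_self_eq_norm_sq, sum_inner]
    refine Finset.sum_congr rfl fun i _ => ?_
    rw [inner_sum]
    refine Finset.sum_congr rfl fun j _ => ?_
    rw [real_inner_smul_left, real_inner_smul_right]
  have h2 : ∑ i, ∑ j, (if prec j i then a i j else 0)
      = ∑ i, levelCoeff b (σ i) * ⟪x i, earlierSum b σ i x⟫ := by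
    refine Finset.sum_congr rfl fun i _ => ?_
    rw [earlierSum, inner_sum, Finset.mul_sum, Finset.sum_filter]
    refine Finset.sum_congr rfl fun j _ => ?_
    simp only [ha, hprec, real_inner_smul_right]
  have h3 : ∑ i, ∑ j, (if prec i j then a i j else 0)
      = ∑ i, ∑ j, (if prec j i then a i j else 0) := by
    rw [Finset.sum_comm]
    refine Finset.sum_congr rfl fun i _ => Finset.sum_congr rfl fun j _ => ?_
    rw [hsymm]
  have h4 : ∑ i, ∑ j, (if j = i then a i j else 0)
      = ∑ i, levelCoeff b (σ i) ^ 2 * ‖x i‖ ^ 2 := by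
    refine Finset.sum_congr rfl fun i _ => ?_
    rw [Finset.sum_ite_eq' Finset.univ i, if_pos (Finset.mem_univ _)]
    simp only [ha, real_inner_self_eq_norm_sq]
    ring
  rw [h1, Finset.sum_congr rfl fun i _ => Finset.sum_congr rfl fun j _ => hsplit i j]
  simp only [Finset.sum_add_distrib]
  rw [h2, h3, h2, h4]
  ring

/-- Outside the bad set, the linear forms on a level `k` are controlled for every configuration: the
levels below `k` can be erased, since they do not enter `earlierDir` on the level `k`. -/
theorem sum_abs_inner_earlierDir_le {L b α t : ℝ} (hL : 0 < L) (hα : 1 ≤ α) {N : ℕ}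
    {x : ι → E} (hx : x ∉ badSet E ι L b α t N) {σ : ι → ℤ} (hσ : ∀ i, (σ i).natAbs ≤ N)
    {k : ℕ} (hk : k ∈ Finset.Icc 1 N) :
    ∑ i with (σ i).natAbs = k, |⟪x i, earlierDir b σ i x⟫| ≤
      L * (3 * ∑ i, (if k ≤ (σ i).natAbs then levelCost α (σ i) else 0)
        + 4 * Fintype.card ι * Real.exp (-(α * 2 ^ k))
        + if ∃ i, (σ i).natAbs = k then t else 0) := by
  obtain ⟨hk1, hkN⟩ := Finset.mem_Icc.1 hk
  have hα0 : 0 ≤ α := by linarith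
  by_cases hex : ∃ i, (σ i).natAbs = k
  · rw [if_pos hex]
    set τ : ι → ℤ := fun i => if k ≤ (σ i).natAbs then σ i else 0 with hτ
    have hτk : ∀ i, (τ i).natAbs = k ↔ (σ i).natAbs = k := by
      intro i
      simp only [hτ]
      split_ifs with h
      · rfl
      · simp; omega
    have hdir : ∀ i, (σ i).natAbs = k → earlierDir b τ i x = earlierDir b σ i x := by
      intro i hi
      have : earlierSum b τ i x = earlierSum b σ i x := by
        unfold earlierSum
        have hi' := (hτk i).2 hi
        refine Finset.sum_congr ?_ ?_
        · ext j
          simp only [Finset.mem_filter, Finset.mem_univ, true_and, hi, hi']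
          simp only [hτ]
          split_ifs with h
          · rfl
          · simp; omega
        · intro j hj
          have : k ≤ (σ j).natAbs := by
            rcases (Finset.mem_filter.1 hj).2 with h | h <;> omega
          simp only [hτ, if_pos this]
      rw [earlierDir, earlierDir, this]
    have hmem : τ ∈ (Fintype.piFinset fun _ : ι => levelRange k N).filter
        fun σ => ∃ i, (σ i).natAbs = k := by
      refine Finset.mem_filter.2 ⟨Fintype.mem_piFinset.2 fun i => mem_levelRange.2 ?_, ?_⟩
      · by_cases h : k ≤ (σ i).natAbs
        · right; simp only [hτ, if_pos h]; exact ⟨h, hσ i⟩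
        · left; simp only [hτ, if_neg h]
      · obtain ⟨i, hi⟩ := hex
        exact ⟨i, (hτk i).2 hi⟩
    have hnot : x ∉ deviationSet E L b α t k τ := fun h =>
      hx (Set.mem_biUnion hk (Set.mem_biUnion hmem h))
    rw [deviationSet, Set.mem_ofPred_eq, not_lt] at hnot
    have hcost : ∀ i, levelCost α (τ i) = if k ≤ (σ i).natAbs then levelCost α (σ i) else 0 := by
      intro i
      simp only [hτ]
      split_ifs with h
      · rfl
      · simp [levelCost]
    simp only [hcost] at hnot
    refine le_trans (le_of_eq ?_) hnot
    refine Finset.sum_congr (Finset.filter_congr fun i _ => (hτk i).symm) fun i hi => ?_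
    rw [hdir i ((hτk i).1 (Finset.mem_filter.1 hi).2)]
  · have : Finset.univ.filter (fun i => (σ i).natAbs = k) = ∅ :=
      Finset.filter_eq_empty_iff.2 fun i _ hi => hex ⟨i, hi⟩
    rw [this, Finset.sum_empty, if_neg hex]
    have : 0 ≤ ∑ i, (if k ≤ (σ i).natAbs then levelCost α (σ i) else 0) :=
      Finset.sum_nonneg fun i _ => by split_ifs <;> simp [levelCost_nonneg hα0]
    positivity

theorem sum_Icc_two_pow_le (m : ℕ) : ∑ k ∈ Finset.Icc 1 m, (2 : ℝ) ^ k ≤ 2 * 2 ^ m := by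
  induction m with
  | zero => simp
  | succ m ih =>
    rw [Finset.sum_Icc_succ_top (by omega), pow_succ]
    linarith

theorem sum_two_pow_mul_exp_le {α : ℝ} (hα : 0 < α) (N : ℕ) :
    ∑ k ∈ Finset.Icc 1 N, 2 ^ k * Real.exp (-(α * 2 ^ k)) ≤ 2 / α ^ 3 := by
  have h1 : ∀ k ∈ Finset.Icc 1 N,
      2 ^ k * Real.exp (-(α * 2 ^ k)) ≤ 6 / α ^ 3 * (1 / 4) ^ k := by
    intro k _
    have h := Real.pow_div_factorial_le_exp (α * 2 ^ k) (by positivity) 3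
    have h6 : ((Nat.factorial 3 : ℕ) : ℝ) = 6 := by norm_num [Nat.factorial]
    rw [h6] at h
    rw [Real.exp_neg]
    have hp : (0 : ℝ) < (α * 2 ^ k) ^ 3 / 6 := by positivity
    calc (2 : ℝ) ^ k * (Real.exp (α * 2 ^ k))⁻¹ ≤ 2 ^ k * ((α * 2 ^ k) ^ 3 / 6)⁻¹ := by gcongr
      _ = 6 / α ^ 3 * (1 / 4) ^ k := by
        have : (4 : ℝ) ^ k = 2 ^ k * 2 ^ k := by rw [← mul_pow]; norm_num
        rw [one_div, inv_pow, this]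
        field_simp
  refine (Finset.sum_le_sum h1).trans ?_
  rw [← Finset.mul_sum]
  have h2 : ∑ k ∈ Finset.Icc 1 N, (1 / 4 : ℝ) ^ k ≤ 1 / 3 := by
    have : ∀ m : ℕ, ∑ k ∈ Finset.Icc 1 m, (1 / 4 : ℝ) ^ k ≤ 1 / 3 - 1 / 3 * (1 / 4) ^ m := by
      intro m
      induction m with
      | zero => simp
      | succ m ih =>
        rw [Finset.sum_Icc_succ_top (by omega), pow_succ]
        linarith
    have h := this N
    have : (0 : ℝ) ≤ 1 / 3 * (1 / 4) ^ N := by positivity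
    linarith
  calc 6 / α ^ 3 * ∑ k ∈ Finset.Icc 1 N, (1 / 4 : ℝ) ^ k ≤ 6 / α ^ 3 * (1 / 3) := by gcongr
    _ = 2 / α ^ 3 := by ring

/-- A self-bounding inequality for the norm of the sum of a configuration, in terms of the largest
norm `M` of a sub-sum. The choice `b = 24 * L * α` makes the coefficient in front of `M` times the
sum of squares equal to `1 / 2`. -/
theorem norm_sq_sum_levelCoeff_le {L b α t R : ℝ} (hL : 0 < L) (hα : 1 ≤ α)
    (hb : b = 24 * L * α) (ht : 0 ≤ t) {N : ℕ}
    {x : ι → E} (hx : x ∉ badSet E ι L b α t N) (hR : ∀ i, ‖x i‖ ^ 2 ≤ R)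
    {σ : ι → ℤ} (hσ : ∀ i, (σ i).natAbs ≤ N) {M : ℝ}
    (hM : ∀ T : Finset ι, ‖∑ i ∈ T, levelCoeff b (σ i) • x i‖ ≤ M) :
    ‖∑ i, levelCoeff b (σ i) • x i‖ ^ 2 ≤ R * ∑ i, levelCoeff b (σ i) ^ 2
      + 2 * M * ((∑ i, levelCoeff b (σ i) ^ 2) / 4 + 192 * Fintype.card ι * L ^ 2 / α ^ 2
        + 2 * t * L * √(∑ i, levelCoeff b (σ i) ^ 2)) := by
  classical
  have hα0 : 0 < α := by linarith
  have hb0 : 0 < b := by rw [hb]; positivity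
  have hM0 : 0 ≤ M := (norm_nonneg _).trans (hM ∅)
  set A : ℝ := ∑ i, levelCoeff b (σ i) ^ 2 with hA
  have hsq : ∀ i, σ i ≠ 0 → levelCoeff b (σ i) ^ 2 = (2 ^ (σ i).natAbs * b) ^ 2 := by
    intro i hi
    rw [← sq_abs, abs_levelCoeff hb0.le hi]
  have hdiag : ∑ i, levelCoeff b (σ i) ^ 2 * ‖x i‖ ^ 2 ≤ R * A := by
    rw [hA, Finset.mul_sum]
    refine Finset.sum_le_sum fun i _ => ?_
    rw [mul_comm]
    exact mul_le_mul_of_nonneg_right (hR i) (sq_nonneg _)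
  -- sort the off-diagonal terms by level
  have hterm : ∀ i, levelCoeff b (σ i) * ⟪x i, earlierSum b σ i x⟫
      ≤ if σ i ≠ 0 then M * b * (2 ^ (σ i).natAbs * |⟪x i, earlierDir b σ i x⟫|) else 0 := by
    intro i
    split_ifs with hi
    · have hv : ‖earlierSum b σ i x‖ ≤ M := hM _
      have h1 : ⟪x i, earlierSum b σ i x⟫ = ‖earlierSum b σ i x‖ * ⟪x i, earlierDir b σ i x⟫ := by
        rw [earlierDir, real_inner_smul_right]
        by_cases h0 : earlierSum b σ i x = 0
        · simp [h0]
        · rw [← mul_assoc, mul_inv_cancel₀ (norm_ne_zero_iff.2 h0), one_mul]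
      calc _ ≤ |levelCoeff b (σ i) * ⟪x i, earlierSum b σ i x⟫| := le_abs_self _
        _ = 2 ^ (σ i).natAbs * b * (‖earlierSum b σ i x‖ * |⟪x i, earlierDir b σ i x⟫|) := by
          rw [h1, abs_mul, abs_mul, abs_levelCoeff hb0.le hi, abs_norm]
        _ ≤ 2 ^ (σ i).natAbs * b * (M * |⟪x i, earlierDir b σ i x⟫|) := by gcongr
        _ = _ := by ring
    · have : σ i = 0 := not_not.1 hi
      simp [this]
  have hoff : ∑ i, levelCoeff b (σ i) * ⟪x i, earlierSum b σ i x⟫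
      ≤ M * b * ∑ k ∈ Finset.Icc 1 N, 2 ^ k *
        ∑ i with (σ i).natAbs = k, |⟪x i, earlierDir b σ i x⟫| := by
    refine (Finset.sum_le_sum fun i _ => hterm i).trans (le_of_eq ?_)
    rw [← Finset.sum_filter, ← Finset.mul_sum]
    congr 1
    rw [← Finset.sum_fiberwise_of_maps_to (t := Finset.Icc 1 N) (g := fun i => (σ i).natAbs)
      (fun i hi => Finset.mem_Icc.2 ⟨Nat.one_le_iff_ne_zero.2
        (Int.natAbs_ne_zero.2 (Finset.mem_filter.1 hi).2), hσ i⟩)]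
    refine Finset.sum_congr rfl fun k hk => ?_
    rw [Finset.mul_sum, Finset.filter_filter]
    refine Finset.sum_congr (Finset.filter_congr fun i _ => ?_) fun i hi => ?_
    · constructor
      · exact fun h => h.2
      · intro h
        refine ⟨?_, h⟩
        rintro h0
        rw [h0] at h
        have := (Finset.mem_Icc.1 hk).1
        simp at h; omega
    · rw [(Finset.mem_filter.1 hi).2]
  have hlev : ∑ k ∈ Finset.Icc 1 N, 2 ^ k *
        ∑ i with (σ i).natAbs = k, |⟪x i, earlierDir b σ i x⟫|
      ≤ 3 * L * (∑ k ∈ Finset.Icc 1 N, 2 ^ k *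
          ∑ i, (if k ≤ (σ i).natAbs then levelCost α (σ i) else 0))
        + 4 * L * Fintype.card ι * (∑ k ∈ Finset.Icc 1 N, 2 ^ k * Real.exp (-(α * 2 ^ k)))
        + L * t * ∑ k ∈ Finset.Icc 1 N with ∃ i, (σ i).natAbs = k, (2 : ℝ) ^ k := by
    refine (Finset.sum_le_sum fun k hk => mul_le_mul_of_nonneg_left
      (sum_abs_inner_earlierDir_le hL hα hx hσ hk) (by positivity)).trans (le_of_eq ?_)
    rw [Finset.sum_filter, Finset.mul_sum, Finset.mul_sum, Finset.mul_sum,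
      ← Finset.sum_add_distrib, ← Finset.sum_add_distrib]
    refine Finset.sum_congr rfl fun k _ => ?_
    split_ifs <;> ring
  have hS1 : ∑ k ∈ Finset.Icc 1 N, 2 ^ k *
      ∑ i, (if k ≤ (σ i).natAbs then levelCost α (σ i) else 0) ≤ 2 * α / b ^ 2 * A := by
    simp only [Finset.mul_sum]
    rw [Finset.sum_comm, hA, Finset.mul_sum]
    refine Finset.sum_le_sum fun i _ => ?_
    by_cases hi : σ i = 0
    · simp [hi, levelCost]
    · rw [hsq i hi, levelCost, if_neg hi]
      calc _ = ∑ k ∈ (Finset.Icc 1 N).filter (fun k => k ≤ (σ i).natAbs),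
            2 ^ k * (α * 2 ^ (σ i).natAbs) := by
            rw [Finset.sum_filter]
            exact Finset.sum_congr rfl fun k _ => by split_ifs <;> simp
        _ ≤ ∑ k ∈ Finset.Icc 1 (σ i).natAbs, 2 ^ k * (α * 2 ^ (σ i).natAbs) := by
            refine Finset.sum_le_sum_of_subset_of_nonneg (fun k hk => ?_) fun _ _ _ => by positivity
            have := Finset.mem_filter.1 hk
            exact Finset.mem_Icc.2 ⟨(Finset.mem_Icc.1 this.1).1, this.2⟩
        _ ≤ 2 * 2 ^ (σ i).natAbs * (α * 2 ^ (σ i).natAbs) := by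
            rw [← Finset.sum_mul]
            gcongr
            exact sum_Icc_two_pow_le _
        _ = 2 * α / b ^ 2 * (2 ^ (σ i).natAbs * b) ^ 2 := by
            field_simp
  have hS2 := sum_two_pow_mul_exp_le hα0 N
  have hS3 : b * ∑ k ∈ Finset.Icc 1 N with ∃ i, (σ i).natAbs = k, (2 : ℝ) ^ k ≤ 2 * √A := by
    set F := (Finset.Icc 1 N).filter fun k => ∃ i, (σ i).natAbs = k with hF
    rcases F.eq_empty_or_nonempty with h | h
    · rw [h]; simp
    · obtain ⟨i, hi⟩ := (Finset.mem_filter.1 (F.max'_mem h)).2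
      have hm1 : 1 ≤ F.max' h := (Finset.mem_Icc.1 (Finset.mem_filter.1 (F.max'_mem h)).1).1
      have hi0 : σ i ≠ 0 := by
        intro h0
        rw [h0] at hi
        simp at hi; omega
      have h1 : ∑ k ∈ F, (2 : ℝ) ^ k ≤ 2 * 2 ^ (F.max' h) := by
        refine le_trans ?_ (sum_Icc_two_pow_le _)
        refine Finset.sum_le_sum_of_subset_of_nonneg (fun k hk => ?_) fun _ _ _ => by positivity
        exact Finset.mem_Icc.2
          ⟨(Finset.mem_Icc.1 (Finset.mem_filter.1 hk).1).1, F.le_max' k hk⟩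
      have h2 : 2 ^ (F.max' h) * b ≤ √A := by
        refine Real.le_sqrt_of_sq_le ?_
        rw [← hi, ← hsq i hi0]
        exact Finset.single_le_sum (f := fun i => levelCoeff b (σ i) ^ 2)
          (fun _ _ => sq_nonneg _) (Finset.mem_univ i)
      calc _ ≤ b * (2 * 2 ^ (F.max' h)) := by gcongr
        _ = 2 * (2 ^ (F.max' h) * b) := by ring
        _ ≤ _ := by gcongr
  rw [norm_sq_sum_levelCoeff]
  have hfin : b * ∑ k ∈ Finset.Icc 1 N, 2 ^ k *
        ∑ i with (σ i).natAbs = k, |⟪x i, earlierDir b σ i x⟫|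
      ≤ A / 4 + 192 * Fintype.card ι * L ^ 2 / α ^ 2 + 2 * t * L * √A := by
    calc _ ≤ b * (3 * L * (2 * α / b ^ 2 * A) + 4 * L * Fintype.card ι * (2 / α ^ 3)
          + L * t * ∑ k ∈ Finset.Icc 1 N with ∃ i, (σ i).natAbs = k, (2 : ℝ) ^ k) := by
          refine mul_le_mul_of_nonneg_left (hlev.trans ?_) hb0.le
          gcongr
      _ = 6 * L * α / b * A + 8 * b * L * Fintype.card ι / α ^ 3
          + L * t * (b * ∑ k ∈ Finset.Icc 1 N with ∃ i, (σ i).natAbs = k, (2 : ℝ) ^ k) := by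
          field_simp
          ring
      _ ≤ 6 * L * α / b * A + 8 * b * L * Fintype.card ι / α ^ 3 + L * t * (2 * √A) := by gcongr
      _ = _ := by
          rw [hb]
          field_simp
          ring
  have := mul_le_mul_of_nonneg_left hfin hM0
  nlinarith

/-- **Large coefficients.** Outside the bad set, the large coefficients `⟪x i, y⟫` of any vector `y`
of the unit ball have a small sum of squares. They are rounded to a configuration of levels; the
sub-configuration with the largest norm `M` satisfies a quadratic inequality in `M`, and `M`
dominates the sum of squares because `y` tests the sum of the configuration. -/
theorem sum_sq_large_inner_le {L b α t R : ℝ} (hL : 0 < L) (hα : 1 ≤ α)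
    (hb : b = 24 * L * α) (ht : 0 ≤ t) (hR0 : 0 ≤ R) {N : ℕ} (hN : R ≤ (2 ^ N * b) ^ 2)
    {x : ι → E} (hx : x ∉ badSet E ι L b α t N) (hR : ∀ i, ‖x i‖ ^ 2 ≤ R)
    {y : E} (hy : ‖y‖ ≤ 1) :
    ∑ i with 2 * b < |⟪x i, y⟫|, ⟪x i, y⟫ ^ 2
      ≤ 16 * R + 6144 * Fintype.card ι * L ^ 2 / α ^ 2 + 256 * t ^ 2 * L ^ 2 := by
  classical
  have hα0 : 0 < α := by linarith
  have hb0 : 0 < b := by rw [hb]; positivity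
  -- the configuration of `y`
  have hex : ∀ i, ∃ k : ℤ, k.natAbs ≤ N ∧ levelCoeff b k ^ 2 ≤ levelCoeff b k * ⟪x i, y⟫ ∧
      (2 * b < |⟪x i, y⟫| → ⟪x i, y⟫ ^ 2 ≤ 4 * levelCoeff b k ^ 2) := by
    intro i
    by_cases hi : 2 * b < |⟪x i, y⟫|
    · obtain ⟨m, hm1, hm2⟩ := exists_nat_pow_near (x := |⟪x i, y⟫| / b) (y := 2)
        ((one_le_div hb0).2 (by linarith)) (by norm_num)
      rw [le_div_iff₀ hb0] at hm1
      rw [div_lt_iff₀ hb0] at hm2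
      have hmN : m ≤ N := by
        by_contra hcon
        have h1 : |⟪x i, y⟫| ≤ ‖x i‖ :=
          (abs_real_inner_le_norm _ _).trans (mul_le_of_le_one_right (norm_nonneg _) hy)
        have h2 : ‖x i‖ ≤ 2 ^ N * b :=
          abs_le_of_sq_le_sq' ((hR i).trans hN) (by positivity) |>.2
        have h3 : (2 : ℝ) ^ (N + 1) ≤ 2 ^ m := pow_le_pow_right₀ (by norm_num) (by omega)
        have h4 : (0 : ℝ) < 2 ^ N * b := by positivity
        rw [pow_succ] at h3
        nlinarith
      have hm0 : m ≠ 0 := by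
        rintro rfl
        simp at hm2
        linarith
      have hms : (m : ℤ) ≠ 0 := by exact_mod_cast hm0
      rw [pow_succ] at hm2
      rcases le_or_gt 0 ⟪x i, y⟫ with hz | hz
      · have hc : levelCoeff b m = 2 ^ m * b := by
          simp [levelCoeff, Int.sign_eq_one_of_pos (show (0 : ℤ) < m by omega)]
        rw [abs_of_nonneg hz] at hm1 hm2
        refine ⟨m, by simpa using hmN, ?_, fun _ => ?_⟩
        · rw [hc, sq]; gcongr
        · rw [hc]; nlinarith
      · have hc : levelCoeff b (-m) = -(2 ^ m * b) := by
          simp [levelCoeff, Int.sign_eq_one_of_pos (show (0 : ℤ) < m by omega)]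
        rw [abs_of_neg hz] at hm1 hm2
        have hp : (0 : ℝ) < 2 ^ m * b := by positivity
        refine ⟨-m, by simpa using hmN, ?_, fun _ => ?_⟩
        · rw [hc]; nlinarith
        · rw [hc]; nlinarith
    · exact ⟨0, by simp, by simp, fun h => absurd h hi⟩
  choose σ hσN hσ1 hσ2 using hex
  -- the sub-configuration with the largest norm
  obtain ⟨T₀, -, hT₀⟩ := Finset.exists_max_image (Finset.univ : Finset (Finset ι))
    (fun T => ‖∑ i ∈ T, levelCoeff b (σ i) • x i‖) Finset.univ_nonempty
  set M : ℝ := ‖∑ i ∈ T₀, levelCoeff b (σ i) • x i‖ with hMdef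
  have hM0 : 0 ≤ M := norm_nonneg _
  have hMT : ∀ T : Finset ι, ‖∑ i ∈ T, levelCoeff b (σ i) • x i‖ ≤ M :=
    fun T => hT₀ T (Finset.mem_univ _)
  set τ : ι → ℤ := fun i => if i ∈ T₀ then σ i else 0 with hτ
  have hτT : ∀ T : Finset ι, ∑ i ∈ T, levelCoeff b (τ i) • x i
      = ∑ i ∈ T with i ∈ T₀, levelCoeff b (σ i) • x i := by
    intro T
    rw [Finset.sum_filter]
    refine Finset.sum_congr rfl fun i _ => ?_
    simp only [hτ]
    split_ifs <;> simp
  have hmain := norm_sq_sum_levelCoeff_le hL hα hb ht hx hR (σ := τ) (M := M)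
    (fun i => by simp only [hτ]; split_ifs <;> simp [hσN]) (fun T => by rw [hτT]; exact hMT _)
  have hττ : ‖∑ i, levelCoeff b (τ i) • x i‖ = M := by
    rw [hτT, hMdef]
    congr 2
    ext; simp
  have hAM : ∑ i, levelCoeff b (σ i) ^ 2 ≤ M := by
    calc ∑ i, levelCoeff b (σ i) ^ 2 ≤ ∑ i, levelCoeff b (σ i) * ⟪x i, y⟫ :=
          Finset.sum_le_sum fun i _ => hσ1 i
      _ = ⟪∑ i, levelCoeff b (σ i) • x i, y⟫ := by
          rw [sum_inner]
          exact Finset.sum_congr rfl fun i _ => (real_inner_smul_left _ _ _).symm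
      _ ≤ ‖∑ i, levelCoeff b (σ i) • x i‖ * ‖y‖ := real_inner_le_norm _ _
      _ ≤ M := (mul_le_of_le_one_right (norm_nonneg _) hy).trans (hMT _)
  have hAτ : ∑ i, levelCoeff b (τ i) ^ 2 ≤ M := by
    refine le_trans (Finset.sum_le_sum fun i _ => ?_) hAM
    simp only [hτ]
    split_ifs
    · exact le_rfl
    · simp [sq_nonneg]
  rw [hττ] at hmain
  set A : ℝ := ∑ i, levelCoeff b (τ i) ^ 2 with hA
  set D : ℝ := 192 * Fintype.card ι * L ^ 2 / α ^ 2 with hD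
  have hM4 : M ≤ 4 * R + 8 * D + 64 * t ^ 2 * L ^ 2 := by
    rcases eq_or_lt_of_le hM0 with h0 | hMpos
    · rw [← h0]; positivity
    · have hs : √A ≤ √M := Real.sqrt_le_sqrt hAτ
      have hsM : √M ^ 2 = M := Real.sq_sqrt hM0
      have h1 : M ^ 2 ≤ M * (R + 2 * (M / 4 + D + 2 * t * L * √M)) := by
        calc M ^ 2 ≤ R * A + 2 * M * (A / 4 + D + 2 * t * L * √A) := hmain
          _ ≤ R * M + 2 * M * (M / 4 + D + 2 * t * L * √M) := by gcongr
          _ = _ := by ring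
      have h2 : M ≤ R + 2 * (M / 4 + D + 2 * t * L * √M) :=
        le_of_mul_le_mul_left (by rwa [← sq]) hMpos
      nlinarith [sq_nonneg (√M - 8 * (t * L))]
  calc ∑ i with 2 * b < |⟪x i, y⟫|, ⟪x i, y⟫ ^ 2
      ≤ ∑ i with 2 * b < |⟪x i, y⟫|, 4 * levelCoeff b (σ i) ^ 2 :=
        Finset.sum_le_sum fun i hi => hσ2 i (Finset.mem_filter.1 hi).2
    _ ≤ ∑ i, 4 * levelCoeff b (σ i) ^ 2 :=
        Finset.sum_le_sum_of_subset_of_nonneg (Finset.subset_univ _) fun _ _ _ => by positivity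
    _ = 4 * ∑ i, levelCoeff b (σ i) ^ 2 := (Finset.mul_sum _ _ _).symm
    _ ≤ 4 * (4 * R + 8 * D + 64 * t ^ 2 * L ^ 2) := by linarith
    _ = _ := by rw [hD]; ring

end LargeCoefficients

/-! ### Moments of the standard Gaussian variable -/

section Gaussian

theorem integrable_pow_gaussianReal (n : ℕ) :
    Integrable (fun s : ℝ => s ^ n) (gaussianReal 0 1) :=
  integrable_pow_of_mem_interior_integrableExpSet (X := id) (by simp) n

/-- The moment recursion, read off the derivatives at `0` of the moment generating function
`exp (t ^ 2 / 2)`. -/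
theorem integral_pow_add_two_gaussianReal (n : ℕ) :
    ∫ s, s ^ (n + 2) ∂gaussianReal 0 1 = (n + 1) * ∫ s, s ^ n ∂gaussianReal 0 1 := by
  set f : ℝ → ℝ := fun t => Real.exp (t ^ 2 / 2) with hf
  have hmom : ∀ n : ℕ, ∫ s, s ^ n ∂gaussianReal 0 1 = iteratedDeriv n f 0 := by
    intro n
    have h := iteratedDeriv_mgf_zero (X := id) (μ := gaussianReal 0 1) (by simp) n
    rw [mgf_id_gaussianReal] at h
    simpa [hf] using h.symm
  have hsmooth : ContDiff ℝ ⊤ f := by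
    simp only [hf]
    fun_prop
  have hD : ∀ n t, HasDerivAt (iteratedDeriv n f) (iteratedDeriv (n + 1) f t) t := by
    intro n t
    rw [iteratedDeriv_succ]
    exact (hsmooth.differentiable_iteratedDeriv n
      (by exact_mod_cast WithTop.coe_lt_top _) t).hasDerivAt
  have hrec : ∀ n, iteratedDeriv (n + 2) f =
      fun t => t * iteratedDeriv (n + 1) f t + (n + 1) * iteratedDeriv n f t := by
    intro n
    induction n with
    | zero =>
      have h1 : iteratedDeriv 1 f = fun t => t * f t := by
        funext t
        have := ((hasDerivAt_pow 2 t).div_const 2).exp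
        rw [iteratedDeriv_one, hf, this.deriv]
        simp [mul_comm]
      funext t
      have h := (hasDerivAt_id t).mul (hD 0 t)
      rw [iteratedDeriv_succ, h1]
      simp only [iteratedDeriv_zero] at h
      have h' : deriv (fun t => t * f t) t = 1 * f t + t * iteratedDeriv 1 f t := h.deriv
      rw [h', h1]
      simp [add_comm]
    | succ n ih =>
      funext t
      have h := ((hasDerivAt_id t).mul (hD (n + 1) t)).add ((hD n t).const_mul ((n : ℝ) + 1))
      have h' : deriv (fun t => t * iteratedDeriv (n + 1) f t + (n + 1) * iteratedDeriv n f t) t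
          = 1 * iteratedDeriv (n + 1) f t + t * iteratedDeriv (n + 1 + 1) f t
            + (n + 1) * iteratedDeriv (n + 1) f t := h.deriv
      rw [show iteratedDeriv (n + 1 + 2) f t = _ from congrFun iteratedDeriv_succ t,
        congrArg deriv ih, h']
      push_cast
      ring
  rw [hmom, hmom, hrec]
  simp

theorem integral_poly_gaussianReal (a : Fin 9 → ℝ) :
    Integrable (fun s => ∑ k, a k * s ^ (k : ℕ)) (gaussianReal 0 1) ∧
    ∫ s, ∑ k, a k * s ^ (k : ℕ) ∂gaussianReal 0 1
      = a 0 + a 2 + 3 * a 4 + 15 * a 6 + 105 * a 8 := by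
  have h0 : ∫ s, s ^ 0 ∂gaussianReal 0 1 = 1 := by simp
  have h1 : ∫ s, s ^ 1 ∂gaussianReal 0 1 = 0 := by
    simp
  have h2 := integral_pow_add_two_gaussianReal 0
  have h3 := integral_pow_add_two_gaussianReal 1
  have h4 := integral_pow_add_two_gaussianReal 2
  have h5 := integral_pow_add_two_gaussianReal 3
  have h6 := integral_pow_add_two_gaussianReal 4
  have h7 := integral_pow_add_two_gaussianReal 5
  have h8 := integral_pow_add_two_gaussianReal 6
  norm_num only [h0, h1] at h2 h3
  norm_num only [h2, h3] at h4 h5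
  norm_num only [h4, h5] at h6 h7
  norm_num only [h6] at h8
  have hint : ∀ k : Fin 9, Integrable (fun s => a k * s ^ (k : ℕ)) (gaussianReal 0 1) :=
    fun k => (integrable_pow_gaussianReal k).const_mul _
  refine ⟨integrable_finsetSum _ fun k _ => hint k, ?_⟩
  rw [integral_finsetSum _ fun k _ => hint k]
  simp only [integral_const_mul, Fin.sum_univ_succ]
  simp [h2, h3, h4, h5, h6, h7, h8]
  ring

theorem integral_sq_sub_gaussianReal (m τ : ℝ) :
    Integrable (fun s => (m + τ * s) ^ 2 - τ ^ 2) (gaussianReal 0 1) ∧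
    ∫ s, ((m + τ * s) ^ 2 - τ ^ 2) ∂gaussianReal 0 1 = m ^ 2 := by
  have h := integral_poly_gaussianReal ![m ^ 2 - τ ^ 2, 2 * m * τ, τ ^ 2, 0, 0, 0, 0, 0, 0]
  have he : (fun s : ℝ => (m + τ * s) ^ 2 - τ ^ 2) = fun s => ∑ k : Fin 9,
      ![m ^ 2 - τ ^ 2, 2 * m * τ, τ ^ 2, 0, 0, 0, 0, 0, 0] k * s ^ (k : ℕ) := by
    funext s
    simp [Fin.sum_univ_succ]
    ring
  rw [he]
  refine ⟨h.1, h.2.trans ?_⟩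
  simp

theorem integral_sq_sub_sq_gaussianReal (m τ : ℝ) :
    Integrable (fun s => ((m + τ * s) ^ 2 - τ ^ 2) ^ 2) (gaussianReal 0 1) ∧
    ∫ s, ((m + τ * s) ^ 2 - τ ^ 2) ^ 2 ∂gaussianReal 0 1
      = m ^ 4 + 4 * m ^ 2 * τ ^ 2 + 2 * τ ^ 4 := by
  set a : Fin 9 → ℝ := ![(m ^ 2 - τ ^ 2) ^ 2, 2 * (m ^ 2 - τ ^ 2) * (2 * m * τ),
    (2 * m * τ) ^ 2 + 2 * (m ^ 2 - τ ^ 2) * τ ^ 2, 2 * (2 * m * τ) * τ ^ 2, τ ^ 4, 0, 0, 0, 0]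
    with ha
  have h := integral_poly_gaussianReal a
  have he : (fun s : ℝ => ((m + τ * s) ^ 2 - τ ^ 2) ^ 2) =
      fun s => ∑ k : Fin 9, a k * s ^ (k : ℕ) := by
    funext s
    simp [Fin.sum_univ_succ, ha]
    ring
  rw [he]
  refine ⟨h.1, h.2.trans ?_⟩
  simp [ha]
  ring

theorem integral_sq_sub_pow_four_gaussianReal (m τ : ℝ) :
    Integrable (fun s => ((m + τ * s) ^ 2 - τ ^ 2) ^ 4) (gaussianReal 0 1) ∧
    ∫ s, ((m + τ * s) ^ 2 - τ ^ 2) ^ 4 ∂gaussianReal 0 1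
      = m ^ 8 + 24 * m ^ 6 * τ ^ 2 + 156 * m ^ 4 * τ ^ 4 + 272 * m ^ 2 * τ ^ 6 + 60 * τ ^ 8 := by
  set p := m ^ 2 - τ ^ 2 with hp
  set q := 2 * m * τ with hq
  set r := τ ^ 2 with hr
  set a : Fin 9 → ℝ := ![p ^ 4, 4 * p ^ 3 * q, 6 * p ^ 2 * q ^ 2 + 4 * p ^ 3 * r,
    4 * p * q ^ 3 + 12 * p ^ 2 * q * r, q ^ 4 + 12 * p * q ^ 2 * r + 6 * p ^ 2 * r ^ 2,
    4 * q ^ 3 * r + 12 * p * q * r ^ 2, 6 * q ^ 2 * r ^ 2 + 4 * p * r ^ 3, 4 * q * r ^ 3, r ^ 4]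
    with ha
  have h := integral_poly_gaussianReal a
  have he : (fun s : ℝ => ((m + τ * s) ^ 2 - r) ^ 4) =
      fun s => ∑ k : Fin 9, a k * s ^ (k : ℕ) := by
    funext s
    simp [Fin.sum_univ_succ, ha]
    have : (m + τ * s) ^ 2 - r = p + q * s + r * s ^ 2 := by rw [hp, hq, hr]; ring
    rw [this]
    ring
  rw [he]
  refine ⟨h.1, h.2.trans ?_⟩
  simp [ha]
  rw [hp, hq, hr]
  ring

/-- The exponent `w + w ^ 2 - 8 * w ^ 4`, truncated from below, has an exponential that is at most
quadratic: this gives a Bernstein-type bound with two moments only. -/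
theorem exp_truncation_le (w : ℝ) :
    Real.exp (max (w + w ^ 2 - 8 * w ^ 4) (-1)) ≤ 1 + w + 4 * w ^ 2 := by
  have h34 : 3 / 4 ≤ 1 + w + 4 * w ^ 2 := by nlinarith [sq_nonneg (4 * w + 1 / 2)]
  rcases max_cases (w + w ^ 2 - 8 * w ^ 4) (-1) with ⟨h, -⟩ | ⟨h, -⟩
  · rw [h]
    by_cases hw : |w| ≤ 1 / 2
    · have hw' := abs_le.1 hw
      have h1 : |w + w ^ 2| ≤ 1 := by
        rw [abs_le]
        constructor <;> nlinarith
      have h2 := Real.abs_exp_sub_one_sub_id_le h1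
      have h3 := (abs_le.1 h2).2
      have h4 : Real.exp (w + w ^ 2 - 8 * w ^ 4) ≤ Real.exp (w + w ^ 2) :=
        Real.exp_le_exp.2 (by nlinarith [sq_nonneg (w ^ 2)])
      nlinarith [sq_nonneg w, mul_nonneg (sq_nonneg w) (by linarith : (0:ℝ) ≤ 1 / 2 - w),
        mul_nonneg (sq_nonneg w) (by nlinarith : (0:ℝ) ≤ 1 / 4 - w ^ 2)]
    · have hw2 : 1 / 4 ≤ w ^ 2 := by
        have := not_le.1 hw
        rw [← sq_abs]
        nlinarith
      have h1 : w + w ^ 2 - 8 * w ^ 4 ≤ 1 / 4 := by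
        nlinarith [sq_nonneg (w - 1 / 2)]
      have h2 : Real.exp (1 / 4) ≤ 4 / 3 := by
        have := Real.add_one_le_exp (-(1 / 4) : ℝ)
        rw [Real.exp_neg] at this
        have h3 := Real.exp_pos (1 / 4 : ℝ)
        rw [le_inv_comm₀ (by norm_num) h3] at this
        norm_num at this ⊢
        linarith
      have h3 := Real.exp_le_exp.2 h1
      rcases le_or_gt 0 w with h0 | h0 <;> nlinarith
  · rw [h]
    have := Real.exp_le_exp.2 (show (-1 : ℝ) ≤ -(1/3) by norm_num)
    have h1 := Real.add_one_le_exp (1 / 3 : ℝ)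
    have : Real.exp (-(1 / 3)) ≤ 3 / 4 := by
      rw [Real.exp_neg, inv_le_comm₀ (Real.exp_pos _) (by norm_num)]
      linarith
    linarith

end Gaussian

/-! ### Shifts of the standard Gaussian measure -/

section GaussianShift

variable {V : Type*} [NormedAddCommGroup V] [InnerProductSpace ℝ V] [FiniteDimensional ℝ V]
  [MeasurableSpace V] [BorelSpace V]

theorem stdGaussian_eq_withDensity : stdGaussian V = (volume : Measure V).withDensity
    fun x => ENNReal.ofReal ((2 * Real.pi) ^ (-(Module.finrank ℝ V / 2 : ℝ)) *
      Real.exp (-‖x‖ ^ 2 / 2)) := by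
  set c : ℝ := (2 * Real.pi) ^ (-(Module.finrank ℝ V / 2 : ℝ)) with hc
  have hc0 : 0 < c := by positivity
  have hint : Integrable (fun x : V => c * Real.exp (-‖x‖ ^ 2 / 2)) := by
    refine Integrable.const_mul (not_imp_comm.1 integral_undef ?_) c
    have h := GaussianFourier.integral_rexp_neg_mul_sq_norm (V := V) (b := 1 / 2) (by norm_num)
    have h' : ∫ x : V, Real.exp (-‖x‖ ^ 2 / 2)
        = (Real.pi / (1 / 2)) ^ (Module.finrank ℝ V / 2 : ℝ) := by
      rw [← h]
      congr 1 with x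
      ring_nf
    rw [h']
    positivity
  have hfin : IsFiniteMeasure ((volume : Measure V).withDensity
      fun x => ENNReal.ofReal (c * Real.exp (-‖x‖ ^ 2 / 2))) :=
    isFiniteMeasure_withDensity_ofReal hint.2
  refine Measure.ext_of_charFun ?_
  funext u
  rw [charFun_stdGaussian, charFun_apply,
    integral_withDensity_eq_integral_toReal_smul (by fun_prop) (by simp)]
  have h := GaussianFourier.integral_cexp_neg_mul_sq_norm_add (V := V) (b := 1 / 2) (by norm_num)
    Complex.I u
  have h2 : ∀ x : V, (ENNReal.ofReal (c * Real.exp (-‖x‖ ^ 2 / 2))).toReal •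
      Complex.exp (⟪x, u⟫ * Complex.I) =
      c * Complex.exp (-(1 / 2) * ‖x‖ ^ 2 + Complex.I * ⟪u, x⟫) := by
    intro x
    rw [ENNReal.toReal_ofReal (by positivity), real_inner_comm, Complex.exp_add, Complex.real_smul]
    push_cast
    ring_nf
  simp only [h2]
  have hcpow : ((Real.pi : ℂ) / (1 / 2)) ^ (Module.finrank ℝ V / 2 : ℂ)
      = (((2 * Real.pi) ^ (Module.finrank ℝ V / 2 : ℝ) : ℝ) : ℂ) := by
    rw [Complex.ofReal_cpow (by positivity)]
    push_cast
    ring_nf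
  have hcc : c * (2 * Real.pi) ^ (Module.finrank ℝ V / 2 : ℝ) = 1 := by
    rw [hc, ← Real.rpow_add (by positivity), neg_add_cancel, Real.rpow_zero]
  rw [integral_const_mul, h, ← mul_assoc, hcpow, ← Complex.ofReal_mul, hcc, Complex.I_sq]
  norm_num

theorem integrable_inner_stdGaussian (v : V) : Integrable (fun g => ⟪g, v⟫) (stdGaussian V) := by
  exact IsGaussian.integrable_id.inner_const v

theorem integral_inner_stdGaussian (v : V) : ∫ g, ⟪g, v⟫ ∂stdGaussian V = 0 := by
  have := integral_strongDual_stdGaussian (innerSL ℝ v)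
  simpa [real_inner_comm] using this

/-- The Cameron–Martin formula for the standard Gaussian measure. -/
theorem lintegral_stdGaussian_shift (v : V) (F : V → ℝ≥0∞) (hF : Measurable F) :
    ∫⁻ g, F (g + v) * ENNReal.ofReal (Real.exp (-⟪g, v⟫ - ‖v‖ ^ 2 / 2)) ∂stdGaussian V
      = ∫⁻ g, F g ∂stdGaussian V := by
  rw [stdGaussian_eq_withDensity, lintegral_withDensity_eq_lintegral_mul _ (by fun_prop) hF,
    lintegral_withDensity_eq_lintegral_mul _ (by fun_prop) (by fun_prop),
    ← lintegral_add_right_eq_self (fun g => ((fun x : V => ENNReal.ofReal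
      ((2 * Real.pi) ^ (-(Module.finrank ℝ V / 2 : ℝ)) * Real.exp (-‖x‖ ^ 2 / 2))) * F) g) v]
  refine lintegral_congr fun g => ?_
  simp only [Pi.mul_apply]
  rw [mul_left_comm, ← ENNReal.ofReal_mul (by positivity), mul_comm, mul_assoc, ← Real.exp_add,
    norm_add_sq_real]
  congr 4
  ring

/-- The Donsker–Varadhan inequality for a shift of the standard Gaussian measure by `v`, whose
relative entropy is `‖v‖ ^ 2 / 2`. -/
theorem integral_shift_le_of_lintegral_exp_le (v : V) {H : V → ℝ} (hH : Measurable H) {c : ℝ}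
    (hc : ∫⁻ g, ENNReal.ofReal (Real.exp (H g)) ∂stdGaussian V ≤ ENNReal.ofReal (Real.exp c))
    (hint : Integrable (fun g => H (g + v)) (stdGaussian V)) :
    ∫ g, H (g + v) ∂stdGaussian V ≤ c + ‖v‖ ^ 2 / 2 := by
  set G : V → ℝ := fun g => H (g + v) + (-⟪g, v⟫ - ‖v‖ ^ 2 / 2) with hG
  have hGm : Measurable G := by
    have : Measurable fun g : V => ⟪g, v⟫ := by fun_prop
    simp only [hG]
    fun_prop
  have hlin : ∫⁻ g, ENNReal.ofReal (Real.exp (G g)) ∂stdGaussian V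
      ≤ ENNReal.ofReal (Real.exp c) := by
    rw [← lintegral_stdGaussian_shift v _ (by fun_prop)] at hc
    refine le_trans (le_of_eq (lintegral_congr fun g => ?_)) hc
    rw [← ENNReal.ofReal_mul (Real.exp_pos _).le, ← Real.exp_add]
  have hGi : Integrable G (stdGaussian V) :=
    hint.add ((integrable_inner_stdGaussian v).neg.sub (integrable_const _))
  have hexp : Integrable (fun g => Real.exp (G g)) (stdGaussian V) := by
    refine ⟨by fun_prop, ?_⟩
    rw [hasFiniteIntegral_iff_ofReal (Filter.Eventually.of_forall fun _ => (Real.exp_pos _).le)]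
    exact hlin.trans_lt ENNReal.ofReal_lt_top
  have hjensen : Real.exp (∫ g, G g ∂stdGaussian V) ≤ ∫ g, Real.exp (G g) ∂stdGaussian V :=
    convexOn_exp.map_integral_le Real.continuous_exp.continuousOn isClosed_univ (by simp) hGi hexp
  have hle : ∫ g, Real.exp (G g) ∂stdGaussian V ≤ Real.exp c := by
    rw [integral_eq_lintegral_of_nonneg_ae
      (Filter.Eventually.of_forall fun _ => (Real.exp_pos _).le) (by fun_prop)]
    exact ENNReal.toReal_le_of_le_ofReal (Real.exp_pos _).le hlin
  have h1 := Real.exp_le_exp.1 (hjensen.trans hle)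
  have h2 : ∫ g, G g ∂stdGaussian V = ∫ g, H (g + v) ∂stdGaussian V - ‖v‖ ^ 2 / 2 := by
    have h3 : Integrable (fun g => -⟪g, v⟫) (stdGaussian V) := (integrable_inner_stdGaussian v).neg
    have h4 : Integrable (fun g => -⟪g, v⟫ - ‖v‖ ^ 2 / 2) (stdGaussian V) :=
      h3.sub (integrable_const _)
    simp only [hG]
    rw [integral_add hint h4, integral_sub h3 (integrable_const _), integral_neg,
      integral_inner_stdGaussian]
    simp
    ring
  linarith

theorem map_inner_stdGaussian (x : V) :
    (stdGaussian V).map (fun g => ⟪x, g⟫) = (gaussianReal 0 1).map (fun s => ‖x‖ * s) := by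
  have h := IsGaussian.map_eq_gaussianReal (μ := stdGaussian V) (innerSL ℝ x)
  rw [integral_strongDual_stdGaussian, variance_dual_stdGaussian] at h
  rw [gaussianReal_map_const_mul]
  convert h using 2 <;> simp
  exact (Real.toNNReal_of_nonneg (sq_nonneg _)).symm

theorem integral_comp_inner_stdGaussian (x : V) {F : ℝ → ℝ} (hF : Continuous F) :
    ∫ g, F ⟪x, g⟫ ∂stdGaussian V = ∫ s, F (‖x‖ * s) ∂gaussianReal 0 1 := by
  have h := congrArg (fun μ => ∫ s, F s ∂μ) (map_inner_stdGaussian x)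
  rwa [integral_map (by fun_prop) (by fun_prop), integral_map (by fun_prop) (by fun_prop)] at h

end GaussianShift

/-! ### PAC-Bayes inequality and quadratic exponents -/

section PACBayes

theorem lintegral_lintegral_exp_sum_le {E Θ ι : Type*} [MeasurableSpace E] [MeasurableSpace Θ]
    [Fintype ι] (ν : Measure E) [IsProbabilityMeasure ν] (π : Measure Θ) [IsProbabilityMeasure π]
    {f h : E → Θ → ℝ} (hf : Measurable (Function.uncurry f)) (hh : Measurable (Function.uncurry h))
    (hint : ∀ θ, Integrable (fun x => h x θ) ν) (hfh : ∀ x θ, Real.exp (f x θ) ≤ 1 + h x θ) :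
    ∫⁻ x, ∫⁻ θ, ENNReal.ofReal (Real.exp (∑ i, f (x i) θ - Fintype.card ι * ∫ z, h z θ ∂ν)) ∂π
      ∂Measure.pi (fun _ : ι => ν) ≤ 1 := by
  have hmean : Measurable fun θ => ∫ z, h z θ ∂ν :=
    (hh.stronglyMeasurable.integral_prod_left' (μ := ν) (f := Function.uncurry h)).measurable
  have hfi : ∀ i : ι, Measurable fun p : (ι → E) × Θ => f (p.1 i) p.2 := fun i =>
    show Measurable (Function.uncurry f ∘ fun p : (ι → E) × Θ => (p.1 i, p.2)) from
      hf.comp (by fun_prop)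
  have hfs : Measurable fun p : (ι → E) × Θ => ∑ i, f (p.1 i) p.2 :=
    Finset.measurable_sum _ fun i _ => hfi i
  rw [lintegral_lintegral_swap (by
    have : Measurable fun p : (ι → E) × Θ => ∫ z, h z p.2 ∂ν := hmean.comp measurable_snd
    exact (by fun_prop : Measurable fun p : (ι → E) × Θ => ENNReal.ofReal
      (Real.exp (∑ i, f (p.1 i) p.2 - Fintype.card ι * ∫ z, h z p.2 ∂ν))).aemeasurable)]
  refine le_trans (lintegral_mono fun θ => ?_) (le_of_eq (by simp : ∫⁻ _ : Θ, (1 : ℝ≥0∞) ∂π = 1))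
  have hfθ : Measurable fun z => ENNReal.ofReal (Real.exp (f z θ)) := by
    have : Measurable fun z => f z θ := hf.comp (measurable_id.prodMk measurable_const)
    fun_prop
  have hone : ∫⁻ z, ENNReal.ofReal (Real.exp (f z θ)) ∂ν
      ≤ ENNReal.ofReal (Real.exp (∫ z, h z θ ∂ν)) := by
    calc ∫⁻ z, ENNReal.ofReal (Real.exp (f z θ)) ∂ν ≤ ∫⁻ z, ENNReal.ofReal (1 + h z θ) ∂ν :=
          lintegral_mono fun z => ENNReal.ofReal_le_ofReal (hfh z θ)
      _ = ENNReal.ofReal (∫ z, (1 + h z θ) ∂ν) :=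
          (ofReal_integral_eq_lintegral_ofReal ((integrable_const _).add (hint θ))
            (Filter.Eventually.of_forall fun z => (Real.exp_pos _).le.trans (hfh z θ))).symm
      _ ≤ _ := by
          refine ENNReal.ofReal_le_ofReal ?_
          rw [integral_add (integrable_const _) (hint θ)]
          have := Real.add_one_le_exp (∫ z, h z θ ∂ν)
          simp
          linarith
  have hprod : ∀ x : ι → E,
      ENNReal.ofReal (Real.exp (∑ i, f (x i) θ - Fintype.card ι * ∫ z, h z θ ∂ν))
      = (∏ i, ENNReal.ofReal (Real.exp (f (x i) θ))) *
        ENNReal.ofReal (Real.exp (-(∫ z, h z θ ∂ν))) ^ Fintype.card ι := by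
    intro x
    rw [← ENNReal.ofReal_prod_of_nonneg fun i _ => (Real.exp_pos _).le, ← Real.exp_sum,
      ← ENNReal.ofReal_pow (Real.exp_pos _).le, ← Real.exp_nat_mul,
      ← ENNReal.ofReal_mul (Real.exp_pos _).le, ← Real.exp_add]
    ring_nf
  have hpi : ∫⁻ x : ι → E, ∏ i, ENNReal.ofReal (Real.exp (f (x i) θ)) ∂Measure.pi (fun _ => ν)
      = (∫⁻ z, ENNReal.ofReal (Real.exp (f z θ)) ∂ν) ^ Fintype.card ι := by
    rw [lintegral_prod_eq_prod_lintegral_of_indepFun Finset.univ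
      (fun i (x : ι → E) => ENNReal.ofReal (Real.exp (f (x i) θ)))
      (iIndepFun_pi fun _ => hfθ.aemeasurable) fun i => hfθ.comp (measurable_pi_apply i)]
    rw [Finset.prod_congr rfl fun i _ =>
      (measurePreserving_eval (fun _ : ι => ν) i).lintegral_comp hfθ]
    rw [Finset.prod_const, Finset.card_univ]
  simp only [hprod]
  rw [lintegral_mul_const _ (by fun_prop), hpi, ← mul_pow]
  refine pow_le_one₀ zero_le ?_
  calc _ ≤ ENNReal.ofReal (Real.exp (∫ z, h z θ ∂ν)) *
        ENNReal.ofReal (Real.exp (-(∫ z, h z θ ∂ν))) := by gcongr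
    _ = 1 := by
      rw [← ENNReal.ofReal_mul (Real.exp_pos _).le, ← Real.exp_add]
      simp

/-- A PAC-Bayes inequality with Gaussian prior: a single event works for all the posteriors that are
shifts of the prior. -/
theorem exists_pacBayes_event {E V ι : Type*} [MeasurableSpace E] [NormedAddCommGroup V]
    [InnerProductSpace ℝ V] [FiniteDimensional ℝ V] [MeasurableSpace V] [BorelSpace V]
    [Fintype ι] (ν : Measure E) [IsProbabilityMeasure ν]
    {f h : E → V → ℝ} (hf : Measurable (Function.uncurry f)) (hh : Measurable (Function.uncurry h))
    (hint : ∀ θ, Integrable (fun x => h x θ) ν) (hfh : ∀ x θ, Real.exp (f x θ) ≤ 1 + h x θ)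
    (t : ℝ) :
    ∃ B : Set (ι → E), MeasurableSet B ∧
      Measure.pi (fun _ => ν) B ≤ ENNReal.ofReal (Real.exp (-t)) ∧
      ∀ x ∉ B, ∀ v : V, (∀ i, Integrable (fun g => f (x i) (g + v)) (stdGaussian V)) →
        Integrable (fun g => ∫ z, h z (g + v) ∂ν) (stdGaussian V) →
        ∑ i, ∫ g, f (x i) (g + v) ∂stdGaussian V
          ≤ Fintype.card ι * ∫ g, ∫ z, h z (g + v) ∂ν ∂stdGaussian V + t + ‖v‖ ^ 2 / 2 := by
  have hmean : Measurable fun θ => ∫ z, h z θ ∂ν :=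
    (hh.stronglyMeasurable.integral_prod_left' (μ := ν) (f := Function.uncurry h)).measurable
  have hfi : ∀ i : ι, Measurable fun p : (ι → E) × V => f (p.1 i) p.2 := fun i =>
    show Measurable (Function.uncurry f ∘ fun p : (ι → E) × V => (p.1 i, p.2)) from
      hf.comp (by fun_prop)
  have hfs : Measurable fun p : (ι → E) × V => ∑ i, f (p.1 i) p.2 :=
    Finset.measurable_sum _ fun i _ => hfi i
  have hJ : Measurable fun p : (ι → E) × V => ENNReal.ofReal
      (Real.exp (∑ i, f (p.1 i) p.2 - Fintype.card ι * ∫ z, h z p.2 ∂ν)) := by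
    have : Measurable fun p : (ι → E) × V => ∫ z, h z p.2 ∂ν := hmean.comp measurable_snd
    fun_prop
  set I : (ι → E) → ℝ≥0∞ := fun x => ∫⁻ θ, ENNReal.ofReal
    (Real.exp (∑ i, f (x i) θ - Fintype.card ι * ∫ z, h z θ ∂ν)) ∂stdGaussian V with hI
  have hIm : Measurable I := hJ.lintegral_prod_right'
  refine ⟨{x | ENNReal.ofReal (Real.exp t) < I x}, measurableSet_lt measurable_const hIm, ?_, ?_⟩
  · have h1 := mul_meas_ge_le_lintegral₀ (μ := Measure.pi fun _ : ι => ν) hIm.aemeasurable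
      (ENNReal.ofReal (Real.exp t))
    have h2 := h1.trans (lintegral_lintegral_exp_sum_le ν (stdGaussian V) hf hh hint hfh)
    have hsub : {x | ENNReal.ofReal (Real.exp t) < I x} ⊆
        {x | ENNReal.ofReal (Real.exp t) ≤ I x} := by
      intro x hx
      exact (show ENNReal.ofReal (Real.exp t) < I x from hx).le
    calc Measure.pi (fun _ => ν) {x | ENNReal.ofReal (Real.exp t) < I x}
        = ENNReal.ofReal (Real.exp (-t)) * (ENNReal.ofReal (Real.exp t) *
          Measure.pi (fun _ => ν) {x | ENNReal.ofReal (Real.exp t) < I x}) := by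
          rw [← mul_assoc, ← ENNReal.ofReal_mul (Real.exp_pos _).le, ← Real.exp_add,
            neg_add_cancel, Real.exp_zero, ENNReal.ofReal_one, one_mul]
      _ ≤ ENNReal.ofReal (Real.exp (-t)) * 1 := by
          gcongr
          exact (by gcongr : _ ≤ _).trans h2
      _ = _ := mul_one _
  · intro x hx v hfint hhint
    have hx' : I x ≤ ENNReal.ofReal (Real.exp t) := not_lt.1 hx
    have hH : Measurable fun θ => ∑ i, f (x i) θ - Fintype.card ι * ∫ z, h z θ ∂ν := by
      have : ∀ i, Measurable fun θ => f (x i) θ := fun i =>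
        hf.comp (measurable_const.prodMk measurable_id)
      fun_prop
    have hs : Integrable (fun g => ∑ i, f (x i) (g + v)) (stdGaussian V) :=
      integrable_finsetSum _ fun i _ => hfint i
    have hm := hhint.const_mul (Fintype.card ι : ℝ)
    have := integral_shift_le_of_lintegral_exp_le v hH hx' (hs.sub hm)
    rw [integral_sub hs hm, integral_finsetSum _ fun i _ => hfint i, integral_const_mul] at this
    linarith

end PACBayes

section QuadraticProcess

/-- The truncated exponent: bounded, at least `-1`, with exponential at most
`1 + w + 4 * w ^ 2`. -/
noncomputable def truncExponent (w : ℝ) : ℝ := max (w + w ^ 2 - 8 * w ^ 4) (-1)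

theorem continuous_truncExponent : Continuous truncExponent := by
  unfold truncExponent; fun_prop

theorem abs_truncExponent_le (w : ℝ) : |truncExponent w| ≤ 2 := by
  unfold truncExponent
  rw [abs_le]
  refine ⟨le_trans (by norm_num) (le_max_right _ _), max_le ?_ (by norm_num)⟩
  nlinarith [sq_nonneg (w - 1 / 2), sq_nonneg (w ^ 2 - 1 / 8)]

variable {V : Type*} [NormedAddCommGroup V] [InnerProductSpace ℝ V]

/-- The variable `lam / β * (⟪x, g⟫ ^ 2 - ‖x‖ ^ 2)`. If `g` is Gaussian with identity covariance and
mean `√β • y`, its expectation is `lam * ⟪x, y⟫ ^ 2`. -/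
noncomputable def quadDev (lam β : ℝ) (x g : V) : ℝ := lam / β * (⟪x, g⟫ ^ 2 - ‖x‖ ^ 2)

theorem continuous_quadDev (lam β : ℝ) :
    Continuous fun p : V × V => quadDev lam β p.1 p.2 := by
  unfold quadDev
  fun_prop

theorem quadDev_add (lam : ℝ) {β : ℝ} (hβ : 0 < β) (x y g : V) :
    quadDev lam β x (g + √β • y)
      = lam * ((⟪x, y⟫ + (√β)⁻¹ * ⟪x, g⟫) ^ 2 - (‖x‖ / √β) ^ 2) := by
  have h := Real.sq_sqrt hβ.le
  have h0 : 0 < √β := Real.sqrt_pos.2 hβ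
  rw [quadDev, inner_add_right, real_inner_smul_right]
  generalize √β = s at h h0
  rw [← h]
  field_simp
  ring

variable [FiniteDimensional ℝ V] [MeasurableSpace V] [BorelSpace V]

theorem integral_comp_quadDev_add (lam : ℝ) {β : ℝ} (hβ : 0 < β) (x y : V) {F : ℝ → ℝ}
    (hF : Continuous F) :
    ∫ g, F (quadDev lam β x (g + √β • y)) ∂stdGaussian V
      = ∫ s, F (lam * ((⟪x, y⟫ + ‖x‖ / √β * s) ^ 2 - (‖x‖ / √β) ^ 2)) ∂gaussianReal 0 1 := by
  simp only [quadDev_add lam hβ]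
  rw [integral_comp_inner_stdGaussian x
    (F := fun u => F (lam * ((⟪x, y⟫ + (√β)⁻¹ * u) ^ 2 - (‖x‖ / √β) ^ 2))) (by fun_prop)]
  congr 1 with s
  ring_nf

/-- For small coefficients the fourth moment of `quadDev` is dominated by the second one; `a` and
`c` stand for `|lam| * ⟪x, y⟫ ^ 2` and `|lam| * ‖x‖ ^ 2 / β`. -/
theorem eight_mul_quartic_le {a c : ℝ} (ha : 0 ≤ a) (hc : 0 ≤ c) (ha' : a ≤ 1 / 100)
    (hc' : c ≤ 1 / 100) :
    8 * (a ^ 4 + 24 * a ^ 3 * c + 156 * a ^ 2 * c ^ 2 + 272 * a * c ^ 3 + 60 * c ^ 4)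
      ≤ a ^ 2 + 4 * a * c + 2 * c ^ 2 := by
  have haa : a * a ≤ 1 / 100 * (1 / 100) := mul_le_mul ha' ha' ha (by norm_num)
  have hcc : c * c ≤ 1 / 100 * (1 / 100) := mul_le_mul hc' hc' hc (by norm_num)
  have hac : 0 ≤ a * c := mul_nonneg ha hc
  have k1 := mul_le_mul_of_nonneg_right haa (mul_self_nonneg a)
  have k2 := mul_le_mul_of_nonneg_right haa hac
  have k3 := mul_le_mul_of_nonneg_right haa (mul_self_nonneg c)
  have k4 := mul_le_mul_of_nonneg_right hcc hac
  have k5 := mul_le_mul_of_nonneg_right hcc (mul_self_nonneg c)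
  have := mul_self_nonneg a
  have := mul_self_nonneg c
  ring_nf at *
  linarith

theorem le_integral_truncExponent {lam β : ℝ} (hβ : 0 < β) {x y : V}
    (hm : |lam| * ⟪x, y⟫ ^ 2 ≤ 1 / 100) (hτ : |lam| * (‖x‖ ^ 2 / β) ≤ 1 / 100) :
    lam * ⟪x, y⟫ ^ 2 ≤ ∫ g, truncExponent (quadDev lam β x (g + √β • y)) ∂stdGaussian V := by
  rw [integral_comp_quadDev_add lam hβ x y continuous_truncExponent]
  set m := ⟪x, y⟫
  set τ := ‖x‖ / √β with hτd
  have hτ2 : τ ^ 2 = ‖x‖ ^ 2 / β := by rw [hτd, div_pow, Real.sq_sqrt hβ.le]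
  rw [← hτ2] at hτ
  obtain ⟨i1, e1⟩ := integral_sq_sub_gaussianReal m τ
  obtain ⟨i2, e2⟩ := integral_sq_sub_sq_gaussianReal m τ
  obtain ⟨i4, e4⟩ := integral_sq_sub_pow_four_gaussianReal m τ
  set W : ℝ → ℝ := fun s => (m + τ * s) ^ 2 - τ ^ 2 with hW
  have j1 : Integrable (fun s => lam * W s) (gaussianReal 0 1) := i1.const_mul lam
  have j2 : Integrable (fun s => lam ^ 2 * W s ^ 2) (gaussianReal 0 1) := i2.const_mul (lam ^ 2)
  have j4 : Integrable (fun s => 8 * lam ^ 4 * W s ^ 4) (gaussianReal 0 1) := i4.const_mul _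
  have hpoly : ∫ s, (lam * W s + lam ^ 2 * W s ^ 2 - 8 * lam ^ 4 * W s ^ 4) ∂gaussianReal 0 1
      = lam * m ^ 2 + lam ^ 2 * (m ^ 4 + 4 * m ^ 2 * τ ^ 2 + 2 * τ ^ 4) - 8 * lam ^ 4 *
        (m ^ 8 + 24 * m ^ 6 * τ ^ 2 + 156 * m ^ 4 * τ ^ 4 + 272 * m ^ 2 * τ ^ 6 + 60 * τ ^ 8) := by
    have j12 : Integrable (fun s => lam * W s + lam ^ 2 * W s ^ 2) (gaussianReal 0 1) := j1.add j2
    rw [integral_sub j12 j4, integral_add j1 j2, integral_const_mul, integral_const_mul,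
      integral_const_mul, e1, e2, e4]
  have hmono : ∫ s, (lam * W s + lam ^ 2 * W s ^ 2 - 8 * lam ^ 4 * W s ^ 4) ∂gaussianReal 0 1
      ≤ ∫ s, truncExponent (lam * W s) ∂gaussianReal 0 1 := by
    refine integral_mono ((j1.add j2).sub j4) ?_ fun s => ?_
    · refine Integrable.of_bound (C := 2) ?_ (Filter.Eventually.of_forall fun s => ?_)
      · have := continuous_truncExponent
        exact (by fun_prop : Continuous fun s => truncExponent (lam * W s)).aestronglyMeasurable
      · exact abs_truncExponent_le _
    · refine le_trans (le_of_eq ?_) (le_max_left _ _)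
      ring
  refine le_trans ?_ (hpoly ▸ hmono)
  -- it remains to absorb the fourth moment into the second one
  set a := |lam| * m ^ 2 with ha
  set c := |lam| * τ ^ 2 with hc
  have ha0 : 0 ≤ a := by positivity
  have hc0 : 0 ≤ c := by positivity
  have hl2 : lam ^ 2 = |lam| ^ 2 := (sq_abs lam).symm
  have hl4 : lam ^ 4 = |lam| ^ 4 := by rw [show lam ^ 4 = (lam ^ 2) ^ 2 by ring, hl2]; ring
  have h1 : lam ^ 2 * (m ^ 4 + 4 * m ^ 2 * τ ^ 2 + 2 * τ ^ 4) = a ^ 2 + 4 * a * c + 2 * c ^ 2 := by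
    rw [hl2, ha, hc]; ring
  have h2 : lam ^ 4 *
        (m ^ 8 + 24 * m ^ 6 * τ ^ 2 + 156 * m ^ 4 * τ ^ 4 + 272 * m ^ 2 * τ ^ 6 + 60 * τ ^ 8)
      = a ^ 4 + 24 * a ^ 3 * c + 156 * a ^ 2 * c ^ 2 + 272 * a * c ^ 3 + 60 * c ^ 4 := by
    rw [hl4, ha, hc]; ring
  have h3 := eight_mul_quartic_le ha0 hc0 hm hτ
  rw [h1, mul_assoc 8, h2]
  linarith

theorem integral_quadDev_add (lam : ℝ) {β : ℝ} (hβ : 0 < β) (x y : V) :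
    ∫ g, (quadDev lam β x (g + √β • y) + 4 * quadDev lam β x (g + √β • y) ^ 2) ∂stdGaussian V
      = lam * ⟪x, y⟫ ^ 2 + 4 * lam ^ 2 *
        (⟪x, y⟫ ^ 4 + 4 * ⟪x, y⟫ ^ 2 * (‖x‖ ^ 2 / β) + 2 * (‖x‖ ^ 4 / β ^ 2)) := by
  rw [integral_comp_quadDev_add lam hβ x y (F := fun w => w + 4 * w ^ 2) (by fun_prop)]
  set m := ⟪x, y⟫
  set τ := ‖x‖ / √β with hτd
  have hτ2 : τ ^ 2 = ‖x‖ ^ 2 / β := by rw [hτd, div_pow, Real.sq_sqrt hβ.le]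
  have hτ4 : τ ^ 4 = ‖x‖ ^ 4 / β ^ 2 := by
    rw [show τ ^ 4 = (τ ^ 2) ^ 2 by ring, hτ2, div_pow]; ring
  obtain ⟨i1, e1⟩ := integral_sq_sub_gaussianReal m τ
  obtain ⟨i2, e2⟩ := integral_sq_sub_sq_gaussianReal m τ
  have j1 := i1.const_mul lam
  have j2 := i2.const_mul (4 * lam ^ 2)
  rw [← hτ2, ← hτ4]
  calc _ = ∫ s, (lam * ((m + τ * s) ^ 2 - τ ^ 2) + 4 * lam ^ 2 * ((m + τ * s) ^ 2 - τ ^ 2) ^ 2)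
        ∂gaussianReal 0 1 := by
        congr 1 with s
        ring
    _ = _ := by
        rw [integral_add j1 j2, integral_const_mul, integral_const_mul, e1, e2]

end QuadraticProcess

/-! ### Truncated quadratic process -/

section TruncatedProcess

variable {V : Type*} [NormedAddCommGroup V] [InnerProductSpace ℝ V]

theorem abs_quadDev_le (lam : ℝ) {β : ℝ} (hβ : 0 < β) (x g : V) :
    |quadDev lam β x g| ≤ |lam| / β * (‖x‖ ^ 2 * (1 + ‖g‖ ^ 2)) := by
  have h1 : |⟪x, g⟫| ≤ ‖x‖ * ‖g‖ := abs_real_inner_le_norm x g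
  have h2 : ⟪x, g⟫ ^ 2 ≤ ‖x‖ ^ 2 * ‖g‖ ^ 2 := by
    rw [← sq_abs, ← mul_pow]
    gcongr
  rw [quadDev, abs_mul, abs_div, abs_of_pos hβ]
  gcongr
  rw [abs_le]
  constructor <;> nlinarith [sq_nonneg ⟪x, g⟫, sq_nonneg ‖x‖, sq_nonneg (‖x‖ * ‖g‖)]

variable [FiniteDimensional ℝ V] [MeasurableSpace V] [BorelSpace V]

theorem integrable_norm_pow_stdGaussian_shift (v : V) (k : ℕ) :
    Integrable (fun g => ‖g + v‖ ^ k) (stdGaussian V) := by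
  have h1 : MemLp (fun g : V => g + v) k (stdGaussian V) :=
    (IsGaussian.memLp_id (stdGaussian V) k (by simp)).add (memLp_const v)
  exact h1.integrable_norm_pow'

theorem integrable_quadDev_prod (ν : Measure V) [IsProbabilityMeasure ν]
    (h4 : Integrable (fun x => ‖x‖ ^ 4) ν) (lam : ℝ) {β : ℝ} (hβ : 0 < β) (v : V) :
    Integrable (fun p : V × V => quadDev lam β p.1 (p.2 + v) + 4 * quadDev lam β p.1 (p.2 + v) ^ 2)
      (ν.prod (stdGaussian V)) := by
  have hc := continuous_quadDev (V := V) lam β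
  have hcont : Continuous fun p : V × V =>
      quadDev lam β p.1 (p.2 + v) + 4 * quadDev lam β p.1 (p.2 + v) ^ 2 := by
    have : Continuous fun p : V × V => quadDev lam β p.1 (p.2 + v) :=
      hc.comp (by fun_prop : Continuous fun p : V × V => (p.1, p.2 + v))
    fun_prop
  have hg : Integrable (fun g : V => (1 + ‖g + v‖ ^ 2) ^ 2) (stdGaussian V) := by
    have := ((integrable_const (1 : ℝ)).add
      ((integrable_norm_pow_stdGaussian_shift v 2).const_mul 2)).add
      (integrable_norm_pow_stdGaussian_shift v 4)
    refine this.congr (Filter.Eventually.of_forall fun g => ?_)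
    simp only [Pi.add_apply]
    ring
  have hx : Integrable (fun x : V => 1 + ‖x‖ ^ 4) ν := (integrable_const _).add h4
  set C := |lam| / β with hC
  have hC0 : 0 ≤ C := by positivity
  refine ((hx.mul_prod hg).const_mul (C + 4 * C ^ 2)).mono' hcont.aestronglyMeasurable
    (Filter.Eventually.of_forall fun p => ?_)
  have h1 := abs_quadDev_le lam hβ p.1 (p.2 + v)
  set w := quadDev lam β p.1 (p.2 + v)
  set A := ‖p.1‖ ^ 2
  set B := 1 + ‖p.2 + v‖ ^ 2
  have hA : 0 ≤ A := sq_nonneg _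
  have hB : 1 ≤ B := by have := sq_nonneg ‖p.2 + v‖; linarith
  have hA4 : ‖p.1‖ ^ 4 = A ^ 2 := by simp only [A]; ring
  have h2 : w ^ 2 ≤ (C * (A * B)) ^ 2 := by
    rw [← sq_abs]; gcongr
  have hAA : A ≤ 1 + A ^ 2 := by nlinarith [sq_nonneg (A - 1)]
  have hBB : B ≤ B ^ 2 := by nlinarith
  have h3 : A * B ≤ (1 + A ^ 2) * B ^ 2 := by gcongr
  have h5 : (A * B) ^ 2 ≤ (1 + A ^ 2) * B ^ 2 := by nlinarith [sq_nonneg B]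
  rw [hA4, Real.norm_eq_abs]
  calc |w + 4 * w ^ 2| ≤ |w| + 4 * w ^ 2 := by
        refine (abs_add_le _ _).trans (le_of_eq ?_)
        rw [abs_of_nonneg (by positivity : 0 ≤ 4 * w ^ 2)]
    _ ≤ C * (A * B) + 4 * (C * (A * B)) ^ 2 := by gcongr
    _ = C * (A * B) + 4 * C ^ 2 * (A * B) ^ 2 := by ring
    _ ≤ C * ((1 + A ^ 2) * B ^ 2) + 4 * C ^ 2 * ((1 + A ^ 2) * B ^ 2) := by gcongr
    _ = _ := by ring

/-- With high probability, for all `y` in the unit ball, the sum of the terms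
`lam * ⟪x i, y⟫ ^ 2` that are small is bounded by its mean, up to an error and to the number of the
large terms. Taking `lam` of either sign gives an upper and a lower bound. -/
theorem exists_truncated_event {ι : Type*} [Fintype ι] (ν : Measure V) [IsProbabilityMeasure ν]
    (h4 : Integrable (fun x => ‖x‖ ^ 4) ν) (lam : ℝ) {β K : ℝ} (hβ : 0 < β)
    (hK : ∀ y : V, ‖y‖ ≤ 1 → ∫ x, ⟪x, y⟫ ^ 4 ∂ν ≤ K) (hK' : ∫ x, ‖x‖ ^ 4 ∂ν ≤ β ^ 2 * K)
    (t : ℝ) :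
    ∃ B : Set (ι → V), MeasurableSet B ∧
      Measure.pi (fun _ => ν) B ≤ ENNReal.ofReal (Real.exp (-t)) ∧
      ∀ x ∉ B, (∀ i, |lam| * (‖x i‖ ^ 2 / β) ≤ 1 / 100) → ∀ y : V, ‖y‖ ≤ 1 →
        (∑ i with |lam| * ⟪x i, y⟫ ^ 2 ≤ 1 / 100, lam * ⟪x i, y⟫ ^ 2)
          - (Finset.univ.filter fun i => ¬ |lam| * ⟪x i, y⟫ ^ 2 ≤ 1 / 100).card
          ≤ Fintype.card ι * (lam * ∫ z, ⟪z, y⟫ ^ 2 ∂ν + 28 * lam ^ 2 * K) + t + β / 2 := by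
  have hc := continuous_quadDev (V := V) lam β
  have hct := continuous_truncExponent
  have hcf : Continuous fun p : V × V => truncExponent (quadDev lam β p.1 p.2) := hct.comp hc
  have hch : Continuous fun p : V × V => quadDev lam β p.1 p.2 + 4 * quadDev lam β p.1 p.2 ^ 2 := by
    fun_prop
  have h2 : Integrable (fun x : V => ‖x‖ ^ 2) ν := by
    refine ((integrable_const (1 : ℝ)).add h4).mono' (by fun_prop)
      (Filter.Eventually.of_forall fun x => ?_)
    rw [Real.norm_eq_abs, abs_of_nonneg (sq_nonneg _), Pi.add_apply]
    nlinarith [sq_nonneg (‖x‖ ^ 2 - 1)]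
  have hinth : ∀ θ : V, Integrable (fun x => quadDev lam β x θ + 4 * quadDev lam β x θ ^ 2) ν := by
    intro θ
    have hcx : Continuous fun x => quadDev lam β x θ :=
      hc.comp (by fun_prop : Continuous fun x : V => (x, θ))
    set C := |lam| / β * (1 + ‖θ‖ ^ 2) with hC
    have hC0 : 0 ≤ C := by positivity
    refine ((h2.const_mul C).add (h4.const_mul (4 * C ^ 2))).mono'
      (by fun_prop) (Filter.Eventually.of_forall fun x => ?_)
    have h1 := abs_quadDev_le lam hβ x θ
    rw [show |lam| / β * (‖x‖ ^ 2 * (1 + ‖θ‖ ^ 2)) = C * ‖x‖ ^ 2 by rw [hC]; ring] at h1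
    set w := quadDev lam β x θ
    have h3 : w ^ 2 ≤ (C * ‖x‖ ^ 2) ^ 2 := by
      rw [← sq_abs]; gcongr
    rw [Real.norm_eq_abs]
    calc |w + 4 * w ^ 2| ≤ |w| + 4 * w ^ 2 := by
          refine (abs_add_le _ _).trans (le_of_eq ?_)
          rw [abs_of_nonneg (by positivity : 0 ≤ 4 * w ^ 2)]
      _ ≤ C * ‖x‖ ^ 2 + 4 * (C * ‖x‖ ^ 2) ^ 2 := by gcongr
      _ = _ := by simp only [Pi.add_apply]; ring
  obtain ⟨B, hBm, hBp, hB⟩ := exists_pacBayes_event (ι := ι) ν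
    (f := fun x θ : V => truncExponent (quadDev lam β x θ))
    (h := fun x θ : V => quadDev lam β x θ + 4 * quadDev lam β x θ ^ 2)
    hcf.measurable hch.measurable hinth
    (fun x θ => (exp_truncation_le _).trans (le_of_eq (add_assoc _ _ _))) t
  refine ⟨B, hBm, hBp, fun x hx hxn y hy => ?_⟩
  have hprod := integrable_quadDev_prod ν h4 lam hβ (√β • y)
  have hfint : ∀ i, Integrable (fun g => truncExponent (quadDev lam β (x i) (g + √β • y)))
      (stdGaussian V) := by
    intro i
    refine Integrable.of_bound (C := 2) ?_
      (Filter.Eventually.of_forall fun g => abs_truncExponent_le _)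
    exact (hcf.comp (by fun_prop : Continuous fun g : V =>
      (x i, g + √β • y))).aestronglyMeasurable
  have hmain := hB x hx (√β • y) hfint hprod.integral_prod_right
  have hnorm : ‖√β • y‖ ^ 2 / 2 ≤ β / 2 := by
    rw [norm_smul, mul_pow, Real.norm_eq_abs, sq_abs, Real.sq_sqrt hβ.le]
    have : ‖y‖ ^ 2 ≤ 1 := pow_le_one₀ (norm_nonneg _) hy
    nlinarith
  have hswap : ∫ g, ∫ z, (quadDev lam β z (g + √β • y) + 4 * quadDev lam β z (g + √β • y) ^ 2) ∂ν
      ∂stdGaussian V ≤ lam * ∫ z, ⟪z, y⟫ ^ 2 ∂ν + 28 * lam ^ 2 * K := by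
    rw [← integral_integral_swap hprod]
    simp only [integral_quadDev_add lam hβ]
    have k2 : Integrable (fun z : V => ⟪z, y⟫ ^ 2) ν := by
      refine h2.mono' (by fun_prop) (Filter.Eventually.of_forall fun z => ?_)
      rw [Real.norm_eq_abs, abs_of_nonneg (sq_nonneg _)]
      have : |⟪z, y⟫| ≤ ‖z‖ :=
        (abs_real_inner_le_norm _ _).trans (mul_le_of_le_one_right (norm_nonneg _) hy)
      rw [← sq_abs]
      gcongr
    have k4 : Integrable (fun z : V => ⟪z, y⟫ ^ 4) ν := by
      refine h4.mono' (by fun_prop) (Filter.Eventually.of_forall fun z => ?_)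
      have : |⟪z, y⟫| ≤ ‖z‖ :=
        (abs_real_inner_le_norm _ _).trans (mul_le_of_le_one_right (norm_nonneg _) hy)
      rw [Real.norm_eq_abs, abs_pow]
      gcongr
    calc _ ≤ ∫ z, (lam * ⟪z, y⟫ ^ 2 + (12 * lam ^ 2 * ⟪z, y⟫ ^ 4
          + 16 * lam ^ 2 / β ^ 2 * ‖z‖ ^ 4)) ∂ν := by
          refine integral_mono (hprod.integral_prod_left.congr
            (Filter.Eventually.of_forall fun z => integral_quadDev_add lam hβ z y))
            ((k2.const_mul _).add ((k4.const_mul _).add (h4.const_mul _))) fun z => ?_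
          have h : 0 ≤ 4 * lam ^ 2 * (2 * (⟪z, y⟫ ^ 2 - ‖z‖ ^ 2 / β) ^ 2) := by positivity
          have h' : ‖z‖ ^ 4 / β ^ 2 = (‖z‖ ^ 2 / β) ^ 2 := by rw [div_pow]; ring
          have h'' : 16 * lam ^ 2 / β ^ 2 * ‖z‖ ^ 4 = 16 * lam ^ 2 * (‖z‖ ^ 2 / β) ^ 2 := by
            rw [← h']; ring
          simp only [h', h'']
          nlinarith
      _ = lam * ∫ z, ⟪z, y⟫ ^ 2 ∂ν + (12 * lam ^ 2 * ∫ z, ⟪z, y⟫ ^ 4 ∂ν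
          + 16 * lam ^ 2 / β ^ 2 * ∫ z, ‖z‖ ^ 4 ∂ν) := by
          have k5 : Integrable (fun z : V => 12 * lam ^ 2 * ⟪z, y⟫ ^ 4
            + 16 * lam ^ 2 / β ^ 2 * ‖z‖ ^ 4) ν := (k4.const_mul _).add (h4.const_mul _)
          rw [integral_add (k2.const_mul _) k5, integral_add (k4.const_mul _) (h4.const_mul _),
            integral_const_mul, integral_const_mul, integral_const_mul]
      _ ≤ lam * ∫ z, ⟪z, y⟫ ^ 2 ∂ν + (12 * lam ^ 2 * K
          + 16 * lam ^ 2 / β ^ 2 * (β ^ 2 * K)) := by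
          have := hK y hy
          gcongr
      _ = _ := by
          field_simp
          ring
  have hlow : (∑ i with |lam| * ⟪x i, y⟫ ^ 2 ≤ 1 / 100, lam * ⟪x i, y⟫ ^ 2)
      - (Finset.univ.filter fun i => ¬ |lam| * ⟪x i, y⟫ ^ 2 ≤ 1 / 100).card
      ≤ ∑ i, ∫ g, truncExponent (quadDev lam β (x i) (g + √β • y)) ∂stdGaussian V := by
    rw [← Finset.sum_filter_add_sum_filter_not Finset.univ
      (fun i => |lam| * ⟪x i, y⟫ ^ 2 ≤ 1 / 100), sub_eq_add_neg]
    refine add_le_add (Finset.sum_le_sum fun i hi =>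
      le_integral_truncExponent hβ (Finset.mem_filter.1 hi).2 (hxn i)) ?_
    rw [← nsmul_one, ← smul_neg, ← Finset.sum_const]
    refine Finset.sum_le_sum fun i _ => ?_
    have : ∫ _ : V, (-1 : ℝ) ∂stdGaussian V = -1 := by simp
    rw [← this]
    exact integral_mono (integrable_const _) (hfint i) fun g => le_max_right _ _
  calc _ ≤ _ := hlow
    _ ≤ _ := hmain
    _ ≤ _ := by gcongr

end TruncatedProcess

/-! ### Uniform concentration of quadratic forms -/

section QuadraticForms

variable {V : Type*} [NormedAddCommGroup V] [InnerProductSpace ℝ V] [FiniteDimensional ℝ V]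
  [MeasurableSpace V] [BorelSpace V]

/-- Uniform concentration of `y ↦ ⟪x, y⟫ ^ 2` on the unit ball for an independent sample with
subexponential marginals, on the event that the sample is bounded. -/
theorem exists_quadratic_event {ι : Type*} [Fintype ι] [LinearOrder ι] (ν : Measure V)
    [IsProbabilityMeasure ν] {K r t : ℝ} (hK : 0 < K) (hr : 0 < r) (ht : 0 ≤ t)
    (hn : 96 ^ 4 * (r + t) ≤ Fintype.card ι)
    (hexp : ∀ u : V, ‖u‖ ≤ 1 → ∫⁻ x, ENNReal.ofReal (Real.exp (|⟪x, u⟫| / (2 * K))) ∂ν ≤ 2)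
    (h4 : Integrable (fun x => ‖x‖ ^ 4) ν)
    (hy4 : ∀ y : V, ‖y‖ ≤ 1 → ∫ x, ⟪x, y⟫ ^ 4 ∂ν ≤ 48 * K ^ 4)
    (hx4 : ∫ x, ‖x‖ ^ 4 ∂ν ≤ r ^ 2 * (48 * K ^ 4)) :
    ∃ B : Set (ι → V), MeasurableSet B ∧
      Measure.pi (fun _ => ν) B ≤ ENNReal.ofReal (3 * Real.exp (-t)) ∧
      ∀ x ∉ B, (∀ i, ‖x i‖ ^ 2 ≤ K ^ 2 * √(r * Fintype.card ι)) → ∀ y : V, ‖y‖ ≤ 1 →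
        |(Fintype.card ι : ℝ)⁻¹ * ∑ i, ⟪x i, y⟫ ^ 2 - ∫ z, ⟪z, y⟫ ^ 2 ∂ν| ≤
          3 * 10 ^ 10 * K ^ 2 * (√((r + t) / Fintype.card ι) + t ^ 2 / Fintype.card ι) := by
  set n : ℝ := (Fintype.card ι : ℝ) with hnd
  have hβ : 0 < r + t := by linarith
  have hn0 : 0 < n := by linarith
  -- `s ^ 4` is the ratio `(r + t) / n`
  set s : ℝ := √(√((r + t) / n)) with hs
  have hs2 : s ^ 2 = √((r + t) / n) := Real.sq_sqrt (Real.sqrt_nonneg _)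
  have hs4 : s ^ 4 = (r + t) / n := by
    rw [show s ^ 4 = (s ^ 2) ^ 2 by ring, hs2, Real.sq_sqrt (by positivity)]
  have hs0 : 0 < s := by positivity
  have hβs : r + t = n * s ^ 4 := by rw [hs4]; field_simp
  have hs96 : s ≤ 1 / 96 := by
    have : s ^ 4 ≤ (1 / 96) ^ 4 := by
      rw [hs4, div_le_iff₀ hn0]
      linarith
    exact le_of_pow_le_pow_left₀ (by norm_num) (by norm_num) this
  -- with these `α` and `b` the threshold `2 * b = K / s` for large coefficients is the one at which
  -- `lam * ⟪x i, y⟫ ^ 2` reaches `1 / 100`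
  set α : ℝ := 1 / (96 * s) with hαd
  have hα : 1 ≤ α := by
    rw [hαd, le_div_iff₀ (by positivity)]
    linarith
  set b : ℝ := K / (2 * s) with hbd
  have hb : b = 24 * (2 * K) * α := by
    rw [hbd, hαd]
    field_simp
    norm_num
  have hb0 : 0 < b := by positivity
  set R : ℝ := K ^ 2 * (n * s ^ 2) with hRd
  have hR0 : 0 ≤ R := by positivity
  have hsqrt : √(r * n) ≤ n * s ^ 2 := by
    refine Real.sqrt_le_iff.2 ⟨by positivity, ?_⟩
    calc r * n ≤ (r + t) * n := by gcongr; linarith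
      _ = (n * s ^ 2) ^ 2 := by rw [hβs]; ring
  obtain ⟨N, hN⟩ : ∃ N : ℕ, R ≤ (2 ^ N * b) ^ 2 := by
    obtain ⟨N, hN⟩ := pow_unbounded_of_one_lt (√R / b) (by norm_num : (1 : ℝ) < 2)
    refine ⟨N, ?_⟩
    rw [div_lt_iff₀ hb0] at hN
    rw [← Real.sq_sqrt hR0]
    gcongr
  -- the choice of `lam` balances `lam ^ 2 * K ^ 4` against `(r + t) / n`
  set lam : ℝ := s ^ 2 / (100 * K ^ 2) with hlam
  have hlam0 : 0 < lam := by positivity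
  have hx4' : ∫ x, ‖x‖ ^ 4 ∂ν ≤ (r + t) ^ 2 * (48 * K ^ 4) := by
    refine hx4.trans ?_
    gcongr
    linarith
  obtain ⟨B₁, hB₁m, hB₁p, hB₁⟩ := exists_truncated_event (ι := ι) ν h4 lam hβ hy4 hx4' t
  obtain ⟨B₂, hB₂m, hB₂p, hB₂⟩ := exists_truncated_event (ι := ι) ν h4 (-lam) hβ hy4 hx4' t
  refine ⟨B₁ ∪ B₂ ∪ badSet V ι (2 * K) b α t N,
    (hB₁m.union hB₂m).union (measurableSet_badSet _ _ _ _ _), ?_, ?_⟩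
  · have hB₃p := measure_badSet_le (ι := ι) ν (by positivity : 0 < 2 * K) hexp (b := b) (t := t)
      hα N
    refine (measure_union_le _ _).trans ((add_le_add (measure_union_le _ _) le_rfl).trans ?_)
    refine (add_le_add (add_le_add hB₁p hB₂p) hB₃p).trans (le_of_eq ?_)
    rw [← ENNReal.ofReal_add (by positivity) (by positivity),
      ← ENNReal.ofReal_add (by positivity) (by positivity)]
    congr 1
    ring
  intro x hx hxR y hy
  simp only [Set.mem_union, not_or] at hx
  obtain ⟨⟨hx₁, hx₂⟩, hx₃⟩ := hx
  have hxR' : ∀ i, ‖x i‖ ^ 2 ≤ R := fun i => (hxR i).trans (by rw [hRd]; gcongr)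
  have hxτ : ∀ i, lam * (‖x i‖ ^ 2 / (r + t)) ≤ 1 / 100 := by
    intro i
    calc lam * (‖x i‖ ^ 2 / (r + t)) ≤ lam * (R / (r + t)) := by
          have := hxR' i
          gcongr
      _ = 1 / 100 := by
          rw [hlam, hRd, hβs]
          field_simp
  have habs : |lam| = lam := abs_of_pos hlam0
  have habs' : |-lam| = lam := by rw [abs_neg, habs]
  have h₁ := hB₁ x hx₁ (by rwa [habs]) y hy
  have h₂ := hB₂ x hx₂ (by rwa [habs']) y hy
  have h₃ := sum_sq_large_inner_le (by positivity : 0 < 2 * K) hα hb ht hR0 hN hx₃ hxR' hy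
  rw [habs] at h₁
  rw [habs'] at h₂
  have hthr : ∀ i, ¬ lam * ⟪x i, y⟫ ^ 2 ≤ 1 / 100 ↔ 2 * b < |⟪x i, y⟫| := by
    intro i
    have e : (2 * b) ^ 2 = K ^ 2 / s ^ 2 := by rw [hbd]; field_simp
    have e' : 1 / 100 = lam * (K ^ 2 / s ^ 2) := by rw [hlam]; field_simp
    rw [not_le, ← sq_lt_sq₀ (a := 2 * b) (by positivity) (abs_nonneg _), sq_abs, e, e',
      mul_lt_mul_iff_right₀ hlam0]
  simp only [hthr] at h₁ h₂
  set G : ℝ := ∑ i with lam * ⟪x i, y⟫ ^ 2 ≤ 1 / 100, ⟪x i, y⟫ ^ 2 with hG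
  set T : ℝ := ∑ i with 2 * b < |⟪x i, y⟫|, ⟪x i, y⟫ ^ 2 with hT
  set m : ℝ := ((Finset.univ.filter fun i => 2 * b < |⟪x i, y⟫|).card : ℝ) with hm
  set Q : ℝ := ∫ z, ⟪z, y⟫ ^ 2 ∂ν with hQ
  have hsplit : ∑ i, ⟪x i, y⟫ ^ 2 = G + T := by
    rw [hG, hT, ← Finset.sum_filter_add_sum_filter_not Finset.univ
      (fun i => lam * ⟪x i, y⟫ ^ 2 ≤ 1 / 100)]
    simp only [hthr]
  have hmT : m ≤ 100 * lam * T := by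
    rw [hm, hT, ← nsmul_one, ← Finset.sum_const, Finset.mul_sum]
    refine Finset.sum_le_sum fun i hi => ?_
    have := not_le.1 ((hthr i).2 (Finset.mem_filter.1 hi).2)
    linarith
  have hT0 : 0 ≤ T := Finset.sum_nonneg fun _ _ => sq_nonneg _
  have hTle : T ≤ 226492432 * K ^ 2 * (n * s ^ 2 + t ^ 2) := by
    refine h₃.trans ?_
    have e : 6144 * n * (2 * K) ^ 2 / α ^ 2 = 226492416 * K ^ 2 * (n * s ^ 2) := by
      rw [hαd]
      field_simp
      ring
    rw [e, hRd]
    have h6 : 0 ≤ K ^ 2 * t ^ 2 := by positivity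
    linarith
  have herr : n * (28 * lam ^ 2 * (48 * K ^ 4)) + t + (r + t) / 2
      ≤ lam * (300 * n * K ^ 2 * s ^ 2) := by
    have e1 : n * (28 * lam ^ 2 * (48 * K ^ 4)) = 1344 / 10000 * (n * s ^ 4) := by
      rw [hlam]
      field_simp
      ring
    have e2 : lam * (300 * n * K ^ 2 * s ^ 2) = 3 * (n * s ^ 4) := by
      rw [hlam]
      field_simp
      ring
    rw [e1, e2, ← hβs]
    linarith
  have e₁ : ∑ i with lam * ⟪x i, y⟫ ^ 2 ≤ 1 / 100, lam * ⟪x i, y⟫ ^ 2 = lam * G :=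
    (Finset.mul_sum _ _ _).symm
  have e₂ : ∑ i with lam * ⟪x i, y⟫ ^ 2 ≤ 1 / 100, -lam * ⟪x i, y⟫ ^ 2 = -lam * G :=
    (Finset.mul_sum _ _ _).symm
  rw [e₁] at h₁
  rw [e₂, neg_sq] at h₂
  have hup : G - n * Q ≤ 100 * T + 300 * n * K ^ 2 * s ^ 2 := by
    refine le_of_mul_le_mul_left ?_ hlam0
    linarith
  have hlo : n * Q - G ≤ 100 * T + 300 * n * K ^ 2 * s ^ 2 := by
    refine le_of_mul_le_mul_left ?_ hlam0
    linarith
  have hfin : |∑ i, ⟪x i, y⟫ ^ 2 - n * Q| ≤ 3 * 10 ^ 10 * K ^ 2 * (n * s ^ 2 + t ^ 2) := by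
    have h5 : 0 ≤ K ^ 2 * (n * s ^ 2) := by positivity
    have h6 : 0 ≤ K ^ 2 * t ^ 2 := by positivity
    rw [hsplit, abs_le]
    constructor <;> linarith
  rw [← hs2]
  calc |n⁻¹ * ∑ i, ⟪x i, y⟫ ^ 2 - Q| = n⁻¹ * |∑ i, ⟪x i, y⟫ ^ 2 - n * Q| := by
        rw [← abs_of_pos (inv_pos.2 hn0), ← abs_mul, abs_of_pos (inv_pos.2 hn0), mul_sub,
          inv_mul_cancel_left₀ hn0.ne']
    _ ≤ n⁻¹ * (3 * 10 ^ 10 * K ^ 2 * (n * s ^ 2 + t ^ 2)) := by gcongr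
    _ = _ := by field_simp

end QuadraticForms

/-! ### Subexponential moments and operator norms -/

section SubexponentialMoments

variable {Ω : Type*} [MeasurableSpace Ω] {μ : Measure Ω}

theorem lintegral_exp_le_of_psiNorm_le {Y : Ω → ℝ} {c₀ c : ℝ}
    (h : psiNorm 1 Y μ ≤ ENNReal.ofReal c₀) (hc : c₀ < c) (hc0 : 0 < c) :
    ∫⁻ ω, ENNReal.ofReal (Real.exp (|Y ω| / c)) ∂μ ≤ 2 := by
  have hlt : psiNorm 1 Y μ < ENNReal.ofReal c :=
    h.trans_lt ((ENNReal.ofReal_lt_ofReal_iff hc0).2 hc)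
  simp only [psiNorm, iInf_lt_iff] at hlt
  obtain ⟨c', hc', hint, hlt⟩ := hlt
  have hle : c' ≤ c := ((ENNReal.ofReal_lt_ofReal_iff hc0).1 hlt).le
  refine le_trans (lintegral_mono fun ω => ENNReal.ofReal_le_ofReal (Real.exp_le_exp.2 ?_)) hint
  rw [Real.rpow_one, Real.rpow_one]
  gcongr

theorem integrable_pow_four_of_lintegral_exp_le {Y : Ω → ℝ} (hY : AEMeasurable Y μ) {c : ℝ}
    (hc : 0 < c) (h : ∫⁻ ω, ENNReal.ofReal (Real.exp (|Y ω| / c)) ∂μ ≤ 2) :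
    Integrable (fun ω => Y ω ^ 4) μ ∧ ∫ ω, Y ω ^ 4 ∂μ ≤ 48 * c ^ 4 := by
  have hexp : Integrable (fun ω => Real.exp (|Y ω| / c)) μ := by
    refine ⟨by fun_prop, ?_⟩
    rw [hasFiniteIntegral_iff_ofReal (Filter.Eventually.of_forall fun _ => (Real.exp_pos _).le)]
    exact h.trans_lt (by simp)
  have hle : ∫ ω, Real.exp (|Y ω| / c) ∂μ ≤ 2 := by
    rw [integral_eq_lintegral_of_nonneg_ae
      (Filter.Eventually.of_forall fun _ => (Real.exp_pos _).le) hexp.1]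
    exact ENNReal.toReal_le_of_le_ofReal (by norm_num) (by simpa using h)
  have hpt : ∀ ω, Y ω ^ 4 ≤ 24 * c ^ 4 * Real.exp (|Y ω| / c) := by
    intro ω
    have h1 := Real.pow_div_factorial_le_exp (|Y ω| / c) (by positivity) 4
    have h2 : ((Nat.factorial 4 : ℕ) : ℝ) = 24 := by norm_num [Nat.factorial]
    rw [h2, div_pow, div_div, div_le_iff₀ (by positivity),
      show |Y ω| ^ 4 = Y ω ^ 4 from (Even.pow_abs (by decide) _)] at h1
    linarith
  have hi : Integrable (fun ω => Y ω ^ 4) μ := by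
    refine (hexp.const_mul (24 * c ^ 4)).mono' (by fun_prop)
      (Filter.Eventually.of_forall fun ω => ?_)
    rw [Real.norm_eq_abs, abs_of_nonneg (by positivity)]
    exact hpt ω
  refine ⟨hi, ?_⟩
  calc ∫ ω, Y ω ^ 4 ∂μ ≤ ∫ ω, 24 * c ^ 4 * Real.exp (|Y ω| / c) ∂μ :=
        integral_mono hi (hexp.const_mul _) hpt
    _ = 24 * c ^ 4 * ∫ ω, Real.exp (|Y ω| / c) ∂μ := integral_const_mul _ _
    _ ≤ 24 * c ^ 4 * 2 := by gcongr
    _ = _ := by ring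

/-- The bound holds with the value `c₀` of the norm itself, including `c₀ = 0`, although the infimum
in `psiNorm` need not be attained there. -/
theorem integral_pow_four_le_of_psiNorm_le {Y : Ω → ℝ} (hY : AEMeasurable Y μ) {c₀ : ℝ}
    (hc₀ : 0 ≤ c₀) (h : psiNorm 1 Y μ ≤ ENNReal.ofReal c₀) :
    Integrable (fun ω => Y ω ^ 4) μ ∧ ∫ ω, Y ω ^ 4 ∂μ ≤ 48 * c₀ ^ 4 := by
  have hall : ∀ c, c₀ < c →
      Integrable (fun ω => Y ω ^ 4) μ ∧ ∫ ω, Y ω ^ 4 ∂μ ≤ 48 * c ^ 4 := fun c hc =>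
    integrable_pow_four_of_lintegral_exp_le hY (hc₀.trans_lt hc)
      (lintegral_exp_le_of_psiNorm_le h hc (hc₀.trans_lt hc))
  refine ⟨(hall (c₀ + 1) (by linarith)).1, ?_⟩
  have hcont : Filter.Tendsto (fun c : ℝ => 48 * c ^ 4) (nhdsWithin c₀ (Set.Ioi c₀))
      (nhds (48 * c₀ ^ 4)) :=
    ((by fun_prop : Continuous fun c : ℝ => 48 * c ^ 4).tendsto c₀).mono_left nhdsWithin_le_nhds
  exact ge_of_tendsto hcont (Filter.eventually_of_mem self_mem_nhdsWithin fun c hc => (hall c hc).2)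

/-- A form of the Cauchy–Schwarz inequality, by weighted means; it allows `a` or `b` to vanish. -/
theorem integral_sq_mul_sq_le {f g : Ω → ℝ} (hf : Integrable (fun ω => f ω ^ 4) μ)
    (hg : Integrable (fun ω => g ω ^ 4) μ) {a b C : ℝ} (ha : 0 ≤ a) (hb : 0 ≤ b) (hC : 0 ≤ C)
    (hfa : ∫ ω, f ω ^ 4 ∂μ ≤ C * a ^ 2) (hgb : ∫ ω, g ω ^ 4 ∂μ ≤ C * b ^ 2) :
    ∫ ω, f ω ^ 2 * g ω ^ 2 ∂μ ≤ C * (a * b) := by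
  have hall : ∀ ε : ℝ, 0 < ε → ∫ ω, f ω ^ 2 * g ω ^ 2 ∂μ ≤ C * ((a + ε) * (b + ε)) := by
    intro ε hε
    have ha' : 0 < a + ε := by linarith
    have hb' : 0 < b + ε := by linarith
    set p := (b + ε) / (2 * (a + ε)) with hp
    set q := (a + ε) / (2 * (b + ε)) with hq
    have hpq : p * q = 1 / 4 := by rw [hp, hq]; field_simp; norm_num
    have hp0 : 0 < p := by positivity
    have hq0 : 0 < q := by positivity
    calc ∫ ω, f ω ^ 2 * g ω ^ 2 ∂μ ≤ ∫ ω, (p * f ω ^ 4 + q * g ω ^ 4) ∂μ := by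
          refine integral_mono_of_nonneg (Filter.Eventually.of_forall fun ω => by positivity)
            ((hf.const_mul p).add (hg.const_mul q)) (Filter.Eventually.of_forall fun ω => ?_)
          have h1 : q = 1 / (4 * p) := by rw [eq_div_iff (by positivity)]; linarith
          have h2 : 0 ≤ (2 * p * f ω ^ 2 - g ω ^ 2) ^ 2 / (4 * p) := by positivity
          have h3 : (2 * p * f ω ^ 2 - g ω ^ 2) ^ 2 / (4 * p)
              = p * f ω ^ 4 + q * g ω ^ 4 - f ω ^ 2 * g ω ^ 2 := by
            rw [h1]; field_simp; ring
          simp only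
          linarith
      _ = p * ∫ ω, f ω ^ 4 ∂μ + q * ∫ ω, g ω ^ 4 ∂μ := by
          rw [integral_add (hf.const_mul p) (hg.const_mul q), integral_const_mul,
            integral_const_mul]
      _ ≤ p * (C * (a + ε) ^ 2) + q * (C * (b + ε) ^ 2) := by
          have h1 : C * a ^ 2 ≤ C * (a + ε) ^ 2 := by gcongr; linarith
          have h2 : C * b ^ 2 ≤ C * (b + ε) ^ 2 := by gcongr; linarith
          have h3 := hfa.trans h1
          have h4 := hgb.trans h2
          gcongr
      _ = _ := by
          rw [hp, hq]
          field_simp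
          ring
  have hcont : Filter.Tendsto (fun ε : ℝ => C * ((a + ε) * (b + ε))) (nhdsWithin 0 (Set.Ioi 0))
      (nhds (C * ((a + 0) * (b + 0)))) :=
    ((by fun_prop : Continuous fun ε : ℝ => C * ((a + ε) * (b + ε))).tendsto 0).mono_left
      nhdsWithin_le_nhds
  simp only [add_zero] at hcont
  exact ge_of_tendsto hcont (Filter.eventually_of_mem self_mem_nhdsWithin hall)

end SubexponentialMoments

section OperatorNorm

theorem opNorm_le_of_abs_quadratic_le {d : ℕ} {M : Matrix (Fin d) (Fin d) ℝ} (hM : Mᵀ = M) {ε : ℝ}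
    (hε : 0 ≤ ε)
    (h : ∀ y : EuclideanSpace ℝ (Fin d), ‖y‖ ≤ 1 → |y.ofLp ⬝ᵥ (M *ᵥ y.ofLp)| ≤ ε) :
    opNorm M ≤ ε := by
  set A := Matrix.toEuclideanCLM (n := Fin d) (𝕜 := ℝ) M with hA
  have hq : ∀ y, |⟪y, A y⟫| ≤ ε * ‖y‖ ^ 2 := by
    intro y
    rcases eq_or_ne y 0 with rfl | hy
    · simp
    · have hy0 : 0 < ‖y‖ := norm_pos_iff.2 hy
      have h1 := h (‖y‖⁻¹ • y) (by rw [norm_smul, norm_inv, norm_norm, inv_mul_cancel₀ hy0.ne'])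
      rw [← Matrix.inner_toEuclideanCLM, ← hA, map_smul, real_inner_smul_left,
        real_inner_smul_right, abs_mul, abs_mul, abs_of_pos (inv_pos.2 hy0)] at h1
      calc |⟪y, A y⟫| = ‖y‖ ^ 2 * (‖y‖⁻¹ * (‖y‖⁻¹ * |⟪y, A y⟫|)) := by field_simp
        _ ≤ ‖y‖ ^ 2 * ε := by gcongr
        _ = _ := mul_comm _ _
  have hsymm : ∀ x y, ⟪x, A y⟫ = ⟪y, A x⟫ := by
    intro x y
    rw [Matrix.inner_toEuclideanCLM, Matrix.inner_toEuclideanCLM, Matrix.dotProduct_mulVec,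
      ← Matrix.mulVec_transpose, hM, dotProduct_comm]
  refine ContinuousLinearMap.opNorm_le_bound _ hε fun x => ?_
  rcases eq_or_ne (A x) 0 with h0 | h0
  · rw [h0, norm_zero]; positivity
  rcases eq_or_ne x 0 with rfl | hx
  · simp
  have hx0 : 0 < ‖x‖ := norm_pos_iff.2 hx
  have hAx0 : 0 < ‖A x‖ := norm_pos_iff.2 h0
  -- polarisation at `x` and the multiple of `A x` of the same length
  set y := (‖x‖ / ‖A x‖) • A x with hy
  have hyn : ‖y‖ = ‖x‖ := by
    rw [hy, norm_smul, Real.norm_eq_abs, abs_of_pos (by positivity), div_mul_cancel₀ _ hAx0.ne']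
  have hyA : ⟪y, A x⟫ = ‖x‖ * ‖A x‖ := by
    rw [hy, real_inner_smul_left, real_inner_self_eq_norm_sq]
    field_simp
  have h1 := (abs_le.1 (hq (x + y))).2
  have h2 := (abs_le.1 (hq (x - y))).1
  have h3 : ⟪x + y, A (x + y)⟫ - ⟪x - y, A (x - y)⟫ = 4 * ⟪y, A x⟫ := by
    simp only [map_add, map_sub, inner_add_left, inner_add_right, inner_sub_left, inner_sub_right,
      hsymm x y]
    ring
  have h4 := parallelogram_law_with_norm ℝ x y
  have h5 : 4 * (‖x‖ * ‖A x‖) ≤ 4 * (‖x‖ * (ε * ‖x‖)) := by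
    rw [← hyA, ← h3]
    rw [hyn] at h4
    nlinarith
  exact le_of_mul_le_mul_left (by linarith) hx0

theorem quadratic_le_opNorm {d : ℕ} (M : Matrix (Fin d) (Fin d) ℝ)
    {y : EuclideanSpace ℝ (Fin d)} (hy : ‖y‖ ≤ 1) :
    y.ofLp ⬝ᵥ (M *ᵥ y.ofLp) ≤ opNorm M := by
  rw [← Matrix.inner_toEuclideanCLM]
  calc _ ≤ ‖y‖ * ‖Matrix.toEuclideanCLM (n := Fin d) (𝕜 := ℝ) M y‖ := real_inner_le_norm _ _
    _ ≤ 1 * (opNorm M * 1) := by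
      gcongr
      exact (ContinuousLinearMap.le_opNorm _ _).trans (by unfold opNorm; gcongr)
    _ = _ := by ring

theorem opNorm_nonneg {d : ℕ} (M : Matrix (Fin d) (Fin d) ℝ) : 0 ≤ opNorm M := norm_nonneg _

theorem eq_zero_of_opNorm_eq_zero {d : ℕ} {M : Matrix (Fin d) (Fin d) ℝ} (h : opNorm M = 0) :
    M = 0 := by
  have := norm_eq_zero.1 h
  simpa using this

theorem quadratic_sampleCovariance {n d : ℕ} (x : Fin n → EuclideanSpace ℝ (Fin d))
    (y : EuclideanSpace ℝ (Fin d)) :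
    y.ofLp ⬝ᵥ (sampleCovariance x *ᵥ y.ofLp) = (n : ℝ)⁻¹ * ∑ i, ⟪x i, y⟫ ^ 2 := by
  rw [sampleCovariance, Matrix.smul_mulVec, dotProduct_smul, smul_eq_mul, Matrix.sum_mulVec,
    dotProduct_sum]
  congr 1
  refine Finset.sum_congr rfl fun i _ => ?_
  have : ⟪x i, y⟫ = (x i).ofLp ⬝ᵥ y.ofLp := by
    rw [EuclideanSpace.inner_eq_star_dotProduct, dotProduct_comm]
    simp
  rw [Matrix.vecMulVec_mulVec, this]
  simp [dotProduct_smul, dotProduct_comm, sq]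

theorem transpose_sampleCovariance {n d : ℕ} (x : Fin n → EuclideanSpace ℝ (Fin d)) :
    (sampleCovariance x)ᵀ = sampleCovariance x := by
  rw [sampleCovariance, Matrix.transpose_smul, Matrix.transpose_sum]
  simp [Matrix.transpose_vecMulVec]

end OperatorNorm

/-! ### Covariance of a centred vector and the main bound -/

section CenteredVector

variable {Ω : Type*} [MeasurableSpace Ω] {μ : Measure Ω} {d : ℕ}
  {X : Ω → EuclideanSpace ℝ (Fin d)}

theorem norm_pow_four_eq_sum (x : EuclideanSpace ℝ (Fin d)) :
    ‖x‖ ^ 4 = ∑ j, ∑ k, x j ^ 2 * x k ^ 2 := by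
  rw [show ‖x‖ ^ 4 = ‖x‖ ^ 2 * ‖x‖ ^ 2 by ring, EuclideanSpace.real_norm_sq_eq, Finset.sum_mul_sum]

theorem integrable_sq_mul_sq {f g : Ω → ℝ} (hfm : AEMeasurable f μ) (hgm : AEMeasurable g μ)
    (hf : Integrable (fun ω => f ω ^ 4) μ) (hg : Integrable (fun ω => g ω ^ 4) μ) :
    Integrable (fun ω => f ω ^ 2 * g ω ^ 2) μ := by
  refine (hf.add hg).mono' (by fun_prop) (Filter.Eventually.of_forall fun ω => ?_)
  rw [Real.norm_eq_abs, abs_of_nonneg (by positivity), Pi.add_apply]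
  nlinarith [sq_nonneg (f ω ^ 2 - g ω ^ 2), sq_nonneg (f ω ^ 2), sq_nonneg (g ω ^ 2)]

theorem integrable_norm_pow_four (hX : AEMeasurable X μ)
    (h4 : ∀ j, Integrable (fun ω => X ω j ^ 4) μ) : Integrable (fun ω => ‖X ω‖ ^ 4) μ := by
  simp only [norm_pow_four_eq_sum]
  exact integrable_finsetSum _ fun j _ => integrable_finsetSum _ fun k _ =>
    integrable_sq_mul_sq (by fun_prop) (by fun_prop) (h4 j) (h4 k)

theorem integral_norm_pow_four_le (hX : AEMeasurable X μ)
    (h4 : ∀ j, Integrable (fun ω => X ω j ^ 4) μ) {C : ℝ} (hC : 0 ≤ C) {a : Fin d → ℝ}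
    (ha : ∀ j, 0 ≤ a j) (hle : ∀ j, ∫ ω, X ω j ^ 4 ∂μ ≤ C * a j ^ 2) :
    ∫ ω, ‖X ω‖ ^ 4 ∂μ ≤ C * (∑ j, a j) ^ 2 := by
  have hint : ∀ j k, Integrable (fun ω => X ω j ^ 2 * X ω k ^ 2) μ := fun j k =>
    integrable_sq_mul_sq (by fun_prop) (by fun_prop) (h4 j) (h4 k)
  simp only [norm_pow_four_eq_sum]
  rw [integral_finsetSum _ fun j _ => integrable_finsetSum _ fun k _ => hint j k, sq,
    Finset.sum_mul_sum, Finset.mul_sum]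
  refine Finset.sum_le_sum fun j _ => ?_
  rw [integral_finsetSum _ fun k _ => hint j k, Finset.mul_sum]
  exact Finset.sum_le_sum fun k _ =>
    integral_sq_mul_sq_le (h4 j) (h4 k) (ha j) (ha k) hC (hle j) (hle k)

theorem memLp_of_integrable_norm_pow_four [IsFiniteMeasure μ] (hX : AEMeasurable X μ)
    (h : Integrable (fun ω => ‖X ω‖ ^ 4) μ) : MemLp X 2 μ := by
  rw [memLp_two_iff_integrable_sq_norm hX.aestronglyMeasurable]
  refine ((integrable_const (1 : ℝ)).add h).mono' (by fun_prop)
    (Filter.Eventually.of_forall fun x => ?_)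
  rw [Real.norm_eq_abs, abs_of_nonneg (sq_nonneg _), Pi.add_apply]
  nlinarith [sq_nonneg (‖X x‖ ^ 2 - 1)]

theorem memLp_coord (hX : MemLp X 2 μ) (j : Fin d) : MemLp (fun ω => X ω j) 2 μ :=
  hX.continuousLinearMap_comp (EuclideanSpace.proj (𝕜 := ℝ) j)

theorem covarianceMatrix_apply_of_centered [IsProbabilityMeasure μ] (hX : MemLp X 2 μ)
    (h0 : ∫ ω, X ω ∂μ = 0)
    (j k : Fin d) : covarianceMatrix X μ j k = ∫ ω, X ω j * X ω k ∂μ := by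
  have hmean : ∀ l, ∫ ω, X ω l ∂μ = 0 := by
    intro l
    have h := (EuclideanSpace.proj (𝕜 := ℝ) l).integral_comp_comm (hX.integrable (by norm_num))
    rw [h0, map_zero] at h
    exact h
  rw [covarianceMatrix, Matrix.of_apply, covariance_eq_sub (memLp_coord hX j) (memLp_coord hX k),
    hmean, zero_mul, sub_zero]
  rfl

theorem integrable_coord_mul_coord (hX : MemLp X 2 μ) (j k : Fin d) :
    Integrable (fun ω => X ω j * X ω k) μ :=
  (memLp_coord hX j).integrable_mul (memLp_coord hX k)

theorem transpose_covarianceMatrix (X : Ω → EuclideanSpace ℝ (Fin d)) (μ : Measure Ω) :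
    (covarianceMatrix X μ)ᵀ = covarianceMatrix X μ := by
  ext j k
  simp [covarianceMatrix, covariance_comm]

theorem inner_eq_sum (x y : EuclideanSpace ℝ (Fin d)) : ⟪x, y⟫ = ∑ j, y j * x j := by
  simp [PiLp.inner_apply]

theorem quadratic_covarianceMatrix [IsProbabilityMeasure μ] (hX : MemLp X 2 μ)
    (h0 : ∫ ω, X ω ∂μ = 0)
    (y : EuclideanSpace ℝ (Fin d)) :
    y.ofLp ⬝ᵥ (covarianceMatrix X μ *ᵥ y.ofLp) = ∫ ω, ⟪X ω, y⟫ ^ 2 ∂μ := by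
  have h : ∀ ω, ⟪X ω, y⟫ ^ 2 = ∑ j, ∑ k, y j * y k * (X ω j * X ω k) := by
    intro ω
    rw [inner_eq_sum, sq, Finset.sum_mul_sum]
    exact Finset.sum_congr rfl fun j _ => Finset.sum_congr rfl fun k _ => by ring
  have hint := fun j k => (integrable_coord_mul_coord hX j k).const_mul (y j * y k)
  simp only [h]
  rw [integral_finsetSum _ fun j _ => integrable_finsetSum _ fun k _ => hint j k]
  simp only [dotProduct, Matrix.mulVec, Finset.mul_sum]
  refine Finset.sum_congr rfl fun j _ => ?_
  rw [integral_finsetSum _ fun k _ => hint j k]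
  refine Finset.sum_congr rfl fun k _ => ?_
  rw [integral_const_mul, covarianceMatrix_apply_of_centered hX h0]
  ring

theorem trace_covarianceMatrix [IsProbabilityMeasure μ] (hX : MemLp X 2 μ) (h0 : ∫ ω, X ω ∂μ = 0) :
    (covarianceMatrix X μ).trace = ∫ ω, ‖X ω‖ ^ 2 ∂μ := by
  simp only [EuclideanSpace.real_norm_sq_eq]
  rw [integral_finsetSum _ fun j _ => by simpa [sq] using integrable_coord_mul_coord hX j j]
  refine Finset.sum_congr rfl fun j _ => ?_
  rw [Matrix.diag_apply, covarianceMatrix_apply_of_centered hX h0]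
  simp only [sq]

theorem opNorm_covarianceMatrix_le_trace [IsProbabilityMeasure μ] (hX : MemLp X 2 μ)
    (h0 : ∫ ω, X ω ∂μ = 0) :
    opNorm (covarianceMatrix X μ) ≤ (covarianceMatrix X μ).trace := by
  have hi : Integrable (fun ω => ‖X ω‖ ^ 2) μ := hX.integrable_norm_pow (by norm_num)
  rw [trace_covarianceMatrix hX h0]
  refine opNorm_le_of_abs_quadratic_le (transpose_covarianceMatrix X μ)
    (integral_nonneg fun _ => sq_nonneg _) fun y hy => ?_
  rw [quadratic_covarianceMatrix hX h0, abs_of_nonneg (integral_nonneg fun _ => sq_nonneg _)]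
  refine integral_mono_of_nonneg (Filter.Eventually.of_forall fun _ => sq_nonneg _) hi
    (Filter.Eventually.of_forall fun ω => ?_)
  have : |⟪X ω, y⟫| ≤ ‖X ω‖ :=
    (abs_real_inner_le_norm _ _).trans (mul_le_of_le_one_right (norm_nonneg _) hy)
  simp only
  rw [← sq_abs ⟪X ω, y⟫]
  gcongr

end CenteredVector

theorem proposition4 :
    ∃ c₁ c₂ c₃ : ℝ, 0 < c₁ ∧ 0 < c₂ ∧ 0 < c₃ ∧
      ∀ (n d : ℕ)
        (Ω₀ : Type*) [MeasurableSpace Ω₀] (μ : Measure Ω₀) [IsProbabilityMeasure μ]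
        (X₀ : Ω₀ → EuclideanSpace ℝ (Fin d))
        (Ω : Type*) [MeasurableSpace Ω] (P : Measure Ω) [IsProbabilityMeasure P]
        (X : Fin n → Ω → EuclideanSpace ℝ (Fin d))
        (S : Matrix (Fin d) (Fin d) ℝ) (κ : ℝ),
        AEMeasurable X₀ μ →
        ∫ ω, X₀ ω ∂μ = 0 →
        S = covarianceMatrix X₀ μ →
        iIndepFun X P →
        (∀ i, IdentDistrib (X i) X₀ P μ) →
        1 ≤ κ →
        (∀ y : EuclideanSpace ℝ (Fin d),
          psiNorm 1 (fun ω => ⟪X₀ ω, y⟫) μ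
            ≤ ENNReal.ofReal (κ * √(y.ofLp ⬝ᵥ (S *ᵥ y.ofLp)))) →
        (∀ᵐ ω ∂P, ∀ i, ‖X i ω‖ ≤ κ * √(opNorm S) * (effectiveRank S * n) ^ (1 / 4 : ℝ)) →
        ∀ t : ℝ, 0 ≤ t →
          c₃ * (effectiveRank S + t) ≤ n →
          1 - c₁ * Real.exp (-t) ≤
            P.real {ω | opNorm (sampleCovariance (fun i => X i ω) - S) ≤
              c₂ * κ ^ 2 * opNorm S * (√((effectiveRank S + t) / n) + t ^ 2 / n)} := by
  refine ⟨3, 3 * 10 ^ 10, 96 ^ 4, by norm_num, by norm_num, by norm_num, ?_⟩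
  intro n d Ω₀ _ μ _ X₀ Ω _ P _ X S κ hX₀ hmean hS hindep hident hκ hpsi hbound t ht hn
  rcases (opNorm_nonneg S).eq_or_lt' with hs0 | hs0
  · -- a vanishing covariance matrix: the almost sure bound makes the sample vanish
    have hS0 := eq_zero_of_opNorm_eq_zero hs0
    have hae : ∀ᵐ ω ∂P, opNorm (sampleCovariance (fun i => X i ω) - S) ≤
        3 * 10 ^ 10 * κ ^ 2 * opNorm S * (√((effectiveRank S + t) / n) + t ^ 2 / n) := by
      filter_upwards [hbound] with ω hω
      have hz : ∀ i, X i ω = 0 := by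
        intro i
        have := hω i
        rw [hs0, Real.sqrt_zero, mul_zero, zero_mul] at this
        exact norm_le_zero_iff.1 this
      have : sampleCovariance (fun i => X i ω) - S = 0 := by
        rw [hS0, sampleCovariance]
        simp [hz]
      rw [this, hs0]
      simp [opNorm]
    have h1 : P.real {ω | opNorm (sampleCovariance (fun i => X i ω) - S) ≤
        3 * 10 ^ 10 * κ ^ 2 * opNorm S * (√((effectiveRank S + t) / n) + t ^ 2 / n)} = 1 := by
      rw [measureReal_def, measure_congr (Filter.eventuallyEq_univ.2 hae), measure_univ,
        ENNReal.toReal_one]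
    rw [h1]
    have := Real.exp_pos (-t)
    linarith
  set s := opNorm S with hsdef
  set r := effectiveRank S with hrdef
  have hκ0 : 0 < κ := by linarith
  set K := κ * √s with hKdef
  have hK : 0 < K := by positivity
  have hK2 : K ^ 2 = κ ^ 2 * s := by rw [hKdef, mul_pow, Real.sq_sqrt hs0.le]
  have hrs : r * s = S.trace := by
    rw [hrdef, effectiveRank, ← hsdef, div_mul_cancel₀ _ hs0.ne']
  -- moments of the one-dimensional marginals
  have hquad_le : ∀ y : EuclideanSpace ℝ (Fin d), ‖y‖ ≤ 1 →
      κ * √(y.ofLp ⬝ᵥ (S *ᵥ y.ofLp)) ≤ K := fun y hy => by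
    rw [hKdef]
    gcongr
    exact quadratic_le_opNorm S hy
  have hinnerm : ∀ y : EuclideanSpace ℝ (Fin d), AEMeasurable (fun ω => ⟪X₀ ω, y⟫) μ := fun y => by
    fun_prop
  have hmom := fun y => integral_pow_four_le_of_psiNorm_le (hinnerm y)
    (by positivity : 0 ≤ κ * √(y.ofLp ⬝ᵥ (S *ᵥ y.ofLp))) (hpsi y)
  have hdiag : ∀ j, 0 ≤ S j j := by
    intro j
    rw [hS, covarianceMatrix, Matrix.of_apply]
    exact integral_nonneg fun _ => mul_self_nonneg _
  have hcoord : ∀ j, Integrable (fun ω => X₀ ω j ^ 4) μ ∧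
      ∫ ω, X₀ ω j ^ 4 ∂μ ≤ 48 * κ ^ 4 * S j j ^ 2 := by
    intro j
    have h := hmom (EuclideanSpace.single j 1)
    have e1 : ∀ ω, ⟪X₀ ω, EuclideanSpace.single j (1 : ℝ)⟫ = X₀ ω j := fun ω => by
      rw [inner_eq_sum]
      simp
    have e2 : (EuclideanSpace.single j (1 : ℝ)).ofLp ⬝ᵥ
        (S *ᵥ (EuclideanSpace.single j (1 : ℝ)).ofLp) = S j j := by simp
    simp only [e1, e2] at h
    refine ⟨h.1, h.2.trans (le_of_eq ?_)⟩
    rw [mul_pow, show √(S j j) ^ 4 = (√(S j j) ^ 2) ^ 2 by ring, Real.sq_sqrt (hdiag j)]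
    ring
  have hnorm4 := integrable_norm_pow_four hX₀ fun j => (hcoord j).1
  have hL2 := memLp_of_integrable_norm_pow_four hX₀ hnorm4
  have hnorm4_le : ∫ ω, ‖X₀ ω‖ ^ 4 ∂μ ≤ r ^ 2 * (48 * K ^ 4) := by
    refine (integral_norm_pow_four_le hX₀ (fun j => (hcoord j).1) (by positivity) hdiag
      fun j => (hcoord j).2).trans (le_of_eq ?_)
    have : ∑ j, S j j = r * s := hrs.symm
    rw [this, show K ^ 4 = (K ^ 2) ^ 2 by ring, hK2]
    ring
  have hr : 0 < r := by
    have : s ≤ S.trace := by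
      rw [hsdef, hS]
      exact opNorm_covarianceMatrix_le_trace hL2 hmean
    rw [hrdef, effectiveRank, ← hsdef]
    exact div_pos (hs0.trans_le this) hs0
  -- pass to the law of the sample
  set ν : Measure (EuclideanSpace ℝ (Fin d)) := μ.map X₀ with hν
  have : IsProbabilityMeasure ν := Measure.isProbabilityMeasure_map hX₀
  have hXm : ∀ i, AEMeasurable (X i) P := fun i => (hident i).aemeasurable_fst
  have hlaw : P.map (fun ω i => X i ω) = Measure.pi fun _ => ν := by
    rw [(iIndepFun_iff_map_fun_eq_pi_map hXm).1 hindep]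
    congr 1
    funext i
    exact (hident i).map_eq
  have hintν : ∀ F : EuclideanSpace ℝ (Fin d) → ℝ, Continuous F →
      ∫ x, F x ∂ν = ∫ ω, F (X₀ ω) ∂μ := fun F hF =>
    integral_map hX₀ hF.aestronglyMeasurable
  obtain ⟨B, hBm, hBp, hB⟩ := exists_quadratic_event (ι := Fin n) ν hK hr ht
    (by rw [Fintype.card_fin]; exact hn)
    (by
      intro u hu
      rw [hν, lintegral_map' (by fun_prop) hX₀]
      exact lintegral_exp_le_of_psiNorm_le (hpsi u)
        ((hquad_le u hu).trans_lt (by linarith)) (by positivity))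
    (by
      rw [hν, integrable_map_measure (by fun_prop) hX₀]
      exact hnorm4)
    (by
      intro y hy
      rw [hintν _ (by fun_prop)]
      refine (hmom y).2.trans ?_
      have := hquad_le y hy
      gcongr)
    (by
      rw [hintν _ (by fun_prop)]
      exact hnorm4_le)
  rw [Fintype.card_fin] at hB
  have hXall : AEMeasurable (fun ω i => X i ω) P := aemeasurable_pi_lambda _ hXm
  have hgood : ∀ᵐ ω ∂P, (fun i => X i ω) ∈ Bᶜ →
      ω ∈ {ω | opNorm (sampleCovariance (fun i => X i ω) - S) ≤
        3 * 10 ^ 10 * κ ^ 2 * s * (√((r + t) / n) + t ^ 2 / n)} := by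
    filter_upwards [hbound] with ω hω hωB
    refine opNorm_le_of_abs_quadratic_le ?_ (by positivity) fun y hy => ?_
    · rw [Matrix.transpose_sub, transpose_sampleCovariance, hS, transpose_covarianceMatrix]
    · have h := hB _ hωB (fun i => ?_) y hy
      · rw [Matrix.sub_mulVec, dotProduct_sub, quadratic_sampleCovariance]
        rw [hintν _ (by fun_prop), ← quadratic_covarianceMatrix hL2 hmean, ← hS] at h
        refine h.trans (le_of_eq ?_)
        rw [hK2]
        ring
      · have h4 : ((r * n) ^ (1 / 4 : ℝ)) ^ 2 = √(r * n) := by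
          rw [Real.sqrt_eq_rpow, ← Real.rpow_natCast, ← Real.rpow_mul (by positivity)]
          norm_num
        calc ‖X i ω‖ ^ 2 ≤ (K * (r * n) ^ (1 / 4 : ℝ)) ^ 2 := by
              have := hω i
              gcongr
          _ = _ := by rw [mul_pow, h4]
  have hBreal : (Measure.pi fun _ : Fin n => ν).real B ≤ 3 * Real.exp (-t) :=
    ENNReal.toReal_le_of_le_ofReal (by positivity) hBp
  calc 1 - 3 * Real.exp (-t) ≤ 1 - (Measure.pi fun _ : Fin n => ν).real B := by linarith
    _ = (Measure.pi fun _ : Fin n => ν).real Bᶜ := (probReal_compl_eq_one_sub hBm).symm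
    _ = P.real ((fun ω i => X i ω) ⁻¹' Bᶜ) := by
        rw [← hlaw, map_measureReal_apply_of_aemeasurable hXall hBm.compl]
    _ ≤ _ := by
        refine ENNReal.toReal_mono (measure_ne_top _ _) (measure_mono_ae ?_)
        filter_upwards [hgood] with ω hω h using hω h
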